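/- Let $d\in\mathbb N$, $T>0$, $\mathbb T^d=\mathbb R^d/\mathbb Z^d$, and let $u^0\in L^2(\mathbb T^d;\mathbb R^d)$ be weakly divergence-free, i.e. $\int_{\mathbb T^d}u^0\cdot\nabla\psi\,dx=0$ for every $\psi\in C^1(\mathbb T^d)$. A vector field $v\in L^2(\mathbb T^d\times(0,T);\mathbb R^d)$ is called a weak solution of the incompressible Euler equations $\partial_t v+\operatorname{div}(v\otimes v)+\nabla p=0$, $\operatorname{div}v=0$ with initial datum $u^0$ if, for almost every $\tau\in(0,T)$, $$\int_0^\tau\!\!\int_{\mathbb T^d}\partial_t\phi\cdot v+\nabla\phi:(v\otimes v)\,dx\,dt=\int_{\mathbb T^d}v(x,\tau)\cdot\phi(x,\tau)-u^0(x)\cdot\phi(x,0)\,dx$$ for every divergence-free $\phi\in C^1(\mathbb T^d\times[0,T];\mathbb R^d)$, and, for almost every $\tau\in(0,T)$, $\int_{\mathbb T^d}v(x,\tau)\cdot\nabla\psi(x)\,dx=0$ for every $\psi\in C^1(\mathbb T^d)$. A weak solution $v$ is globally admissible if $v\in L^\infty(0,T;L^2(\mathbb T^d))$ and $\frac12\int_{\mathbb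 T^d}|v(x,\tau)|^2dx\le\frac12\int_{\mathbb T^d}|u^0(x)|^2dx$ for almost every $\tau\in(0,T)$. Let $u$ be a globally admissible weak solution with initial datum $u^0$. Let $U\in L^\infty(0,T;L^2(\mathbb T^d))$ be a weak solution with the same initial datum $u^0$ such that $U(\cdot,t)\in C^1(\mathbb T^d)$ for almost every $t\in(0,T)$ and $\nabla_{sym}U\in L^1(0,T;L^\infty(\mathbb T^d))$, where $\nabla_{sym}U=\frac12(\nabla U+\nabla U^{\top})$. No regularity of $U$ in time is assumed. Then $u(x,t)=U(x,t)$ for almost every $(x,t)\in\mathbb T^d\times(0,T)$. -/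

import Mathlib

open MeasureTheory Set
open scoped ENNReal

noncomputable section

namespace EulerTorus

/-- The flat torus `𝕋^d = ℝ^d / ℤ^d`, with its product (Haar probability) measure. -/
abbrev Torus (d : ℕ) : Type := UnitAddTorus (Fin d)

/-- `ℝ^d` with the Euclidean norm, where velocity fields take their values. -/
abbrev Vec (d : ℕ) : Type := EuclideanSpace ℝ (Fin d)

/-- The quotient map `ℝ^d → 𝕋^d`. -/
def toTorus {d : ℕ} (y : Fin d → ℝ) : Torus d := fun i => (y i : UnitAddCircle)

/-- `f : 𝕋^d → F` is of class `C¹`: its periodic lift to `ℝ^d` is. -/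
def IsC1 {d : ℕ} {F : Type*} [NormedAddCommGroup F] [NormedSpace ℝ F] (f : Torus d → F) : Prop :=
  ContDiff ℝ 1 (fun y : Fin d → ℝ => f (toTorus y))

/-- `φ(t, x)` is of class `C¹` in time and space jointly. The functions of class `C¹` on
`𝕋^d × [0, T]` are exactly the restrictions of such functions (reflect in the time variable). -/
def IsC1TimeSpace {d : ℕ} {F : Type*} [NormedAddCommGroup F] [NormedSpace ℝ F]
    (φ : ℝ → Torus d → F) : Prop :=
  ContDiff ℝ 1 (fun z : ℝ × (Fin d → ℝ) => φ z.1 (toTorus z.2))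

/-- The partial derivative `∂ᵢ f (x)` of a function on the torus. -/
def pderiv {d : ℕ} {F : Type*} [NormedAddCommGroup F] [NormedSpace ℝ F]
    (i : Fin d) (f : Torus d → F) (x : Torus d) : F :=
  deriv (fun s : ℝ => f (x + toTorus (Pi.single i s))) 0

/-- The divergence `∑ᵢ ∂ᵢ vⁱ` of a vector field. -/
def divergence {d : ℕ} (v : Torus d → Vec d) (x : Torus d) : ℝ :=
  ∑ i, pderiv i v x i

/-- The symmetric gradient, `(∇_sym v)ᵢⱼ = (∂ⱼ vⁱ + ∂ᵢ vʲ) / 2`. -/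
def symGrad {d : ℕ} (v : Torus d → Vec d) (x : Torus d) : Fin d → Fin d → ℝ :=
  fun i j => (pderiv j v x i + pderiv i v x j) / 2

/-- Lebesgue measure on the time interval `(0, T)`. -/
def timeMeasure (T : ℝ) : Measure ℝ := volume.restrict (Ioo 0 T)

/-- Lebesgue measure on `(0, T) × 𝕋^d`. -/
def spaceTimeMeasure (d : ℕ) (T : ℝ) : Measure (ℝ × Torus d) :=
  (timeMeasure T).prod volume

/-- `f ∈ L^p(0, T; L^q(𝕋^d))`. -/
structure MemLpLq {d : ℕ} {F : Type*} [NormedAddCommGroup F]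
    (p q : ℝ≥0∞) (T : ℝ) (f : ℝ → Torus d → F) : Prop where
  aestronglyMeasurable : AEStronglyMeasurable (Function.uncurry f) (spaceTimeMeasure d T)
  aemeasurable_norm : AEMeasurable (fun t => eLpNorm (f t) q volume) (timeMeasure T)
  norm_lt_top : eLpNorm (fun t => eLpNorm (f t) q volume) p (timeMeasure T) < ∞

/-- `v` is divergence-free in the weak sense: `∫ v · ∇ψ dx = 0` for all `ψ ∈ C¹(𝕋^d)`. -/
def IsWeaklyDivFree {d : ℕ} (v : Torus d → Vec d) : Prop :=
  ∀ ψ : Torus d → ℝ, IsC1 ψ → ∫ x, ∑ i, v x i * pderiv i ψ x = 0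

/-- `u ∈ L²(𝕋^d × (0, T))` is a weak solution of the incompressible Euler equations
`∂ₜ u + div (u ⊗ u) + ∇p = 0`, `div u = 0` with initial datum `u₀`; here `∇φ : (u ⊗ u)` is
`∑ᵢⱼ ∂ⱼφⁱ uⁱ uʲ`. -/
structure IsWeakSolution {d : ℕ} (T : ℝ) (u₀ : Torus d → Vec d) (u : ℝ → Torus d → Vec d) :
    Prop where
  memLp : MemLp (Function.uncurry u) 2 (spaceTimeMeasure d T)
  momentum : ∀ᵐ τ ∂(timeMeasure T), ∀ φ : ℝ → Torus d → Vec d, IsC1TimeSpace φ →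
    (∀ t ∈ Icc 0 T, ∀ x, divergence (φ t) x = 0) →
    ∫ t in (0 : ℝ)..τ, ∫ x, (∑ i, deriv (fun s => φ s x) t i * u t x i +
        ∑ i, ∑ j, pderiv j (φ t) x i * (u t x i * u t x j)) =
      ∫ x, (∑ i, u τ x i * φ τ x i - ∑ i, u₀ x i * φ 0 x i)
  divFree : ∀ᵐ τ ∂(timeMeasure T), IsWeaklyDivFree (u τ)

/-- A globally admissible weak solution: a weak solution in `L^∞(0, T; L²)` whose kinetic energy
never exceeds that of the initial datum. -/
structure IsGloballyAdmissible {d : ℕ} (T : ℝ) (u₀ : Torus d → Vec d)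
    (u : ℝ → Torus d → Vec d) : Prop extends IsWeakSolution T u₀ u where
  memLinftyL2 : MemLpLq ∞ 2 T u
  energy_le : ∀ᵐ τ ∂(timeMeasure T),
    (1 / 2 : ℝ) * ∫ x, ‖u τ x‖ ^ 2 ≤ (1 / 2 : ℝ) * ∫ x, ‖u₀ x‖ ^ 2

end EulerTorus

end

noncomputable section

namespace EulerTorus

open Filter Topology

/-! The proof compares the two solutions through the relative energy `E = ∫ |u - U|²`, which expands
to `∫ |u|² + ∫ |U|² - 2 ∫ u · U`. Write `S = ∇_sym U` and `w = u - U`. Formally the Euler equations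
and incompressibility give `d/dt ∫ u · U = ∫ S : (w ⊗ w)`. Taking `u = U` shows that `U` conserves
energy, and admissibility bounds `∫ |u|²` by the same initial energy. Hence `E(τ) ≤ -2 ∫₀^τ ∫ S : (w
⊗ w) ≤ 2d ∫₀^τ ‖S‖_∞ E`, and Grönwall forces `E = 0`.

The formal step would use `U` as a test field, which its lack of time regularity forbids. Only
stationary solenoidal trigonometric fields are tested: each Fourier coefficient of a weak solution
is then almost everywhere the primitive of an integrable function (`IsWeakSolution.ae_coef_eq`), and
the product rule applies mode by mode. A trigonometric polynomial kernel sums finitely many modes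
into a mollified inner product whose evolution is exact (`IsWeakSolution.mollInner_eq`).

The kernel is then removed. At a fixed time, derivatives are moved onto the `C¹` field and
rearranged so that only `S` appears (`mollRate_eq`). This yields pointwise convergence of the rates
and a bound affine in `‖S‖_∞`, integrable in time, so dominated convergence gives
`IsWeakSolution.integral_inner_eq`. Completing the square is `neg_limitRate_le`; the conclusion is
`IsGloballyAdmissible.ae_relativeEnergy_eq_zero`. -/

variable {d : ℕ} {T : ℝ} {F : Type*} [NormedAddCommGroup F] [NormedSpace ℝ F]

/-! ### Differential calculus on the torus through periodic lifts -/

lemma toTorus_add (y z : Fin d → ℝ) : toTorus (y + z) = toTorus y + toTorus z := by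
  funext i
  simp [toTorus]

/-- This lets continuity on the torus be checked on periodic lifts, where `IsC1` is defined. -/
lemma isOpenQuotientMap_toTorus : IsOpenQuotientMap (toTorus : (Fin d → ℝ) → Torus d) :=
  IsOpenQuotientMap.piMap fun _ => QuotientAddGroup.isOpenQuotientMap_mk

lemma single_eq_smul (i : Fin d) (s : ℝ) :
    (Pi.single i s : Fin d → ℝ) = s • Pi.single i 1 := by
  rw [← Pi.single_smul, smul_eq_mul, mul_one]

lemma toTorus_single_zero (i : Fin d) : toTorus (Pi.single i (0 : ℝ)) = (0 : Torus d) := by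
  funext j
  simp [toTorus]

lemma IsC1.continuous {f : Torus d → F} (hf : IsC1 f) : Continuous f :=
  isOpenQuotientMap_toTorus.isQuotientMap.continuous_iff.2 (ContDiff.continuous hf)

lemma IsC1.hasDerivAt_toTorus {f : Torus d → F} (hf : IsC1 f) (i : Fin d) (y : Fin d → ℝ) :
    HasDerivAt (fun s : ℝ => f (toTorus y + toTorus (Pi.single i s)))
      (fderiv ℝ (fun y : Fin d → ℝ => f (toTorus y)) y (Pi.single i 1)) 0 := by
  have h1 : HasFDerivAt (fun y : Fin d → ℝ => f (toTorus y))
      (fderiv ℝ (fun y : Fin d → ℝ => f (toTorus y)) y) (y + (0 : ℝ) • Pi.single i 1) := by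
    rw [zero_smul, add_zero]
    exact ((ContDiff.differentiable hf one_ne_zero) y).hasFDerivAt
  have h2 : HasDerivAt (fun s : ℝ => y + s • (Pi.single i 1 : Fin d → ℝ)) (Pi.single i 1) 0 := by
    simpa using ((hasDerivAt_id (0 : ℝ)).smul_const (Pi.single i 1 : Fin d → ℝ)).const_add y
  have h3 := h1.comp_hasDerivAt (0 : ℝ) h2
  refine h3.congr_of_eventuallyEq (Eventually.of_forall fun s => ?_)
  simp only [Function.comp_apply, ← toTorus_add, single_eq_smul i s]

lemma IsC1.pderiv_toTorus {f : Torus d → F} (hf : IsC1 f) (i : Fin d) (y : Fin d → ℝ) :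
    pderiv i f (toTorus y) = fderiv ℝ (fun y : Fin d → ℝ => f (toTorus y)) y (Pi.single i 1) :=
  (hf.hasDerivAt_toTorus i y).deriv

lemma IsC1.hasDerivAt {f : Torus d → F} (hf : IsC1 f) (i : Fin d) (x : Torus d) :
    HasDerivAt (fun s : ℝ => f (x + toTorus (Pi.single i s))) (pderiv i f x) 0 := by
  obtain ⟨y, rfl⟩ := isOpenQuotientMap_toTorus.surjective x
  rw [hf.pderiv_toTorus]
  exact hf.hasDerivAt_toTorus i y

lemma IsC1.hasDerivAt_line {f : Torus d → F} (hf : IsC1 f) (i : Fin d) (x : Torus d) (s : ℝ) :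
    HasDerivAt (fun s : ℝ => f (x + toTorus (Pi.single i s)))
      (pderiv i f (x + toTorus (Pi.single i s))) s := by
  have h := hf.hasDerivAt i (x + toTorus (Pi.single i s))
  have h2 : HasDerivAt (fun r : ℝ => r - s) 1 s := (hasDerivAt_id s).sub_const s
  rw [← sub_self s] at h
  have h3 := HasDerivAt.scomp (h := fun r : ℝ => r - s) s h h2
  rw [one_smul] at h3
  refine h3.congr_of_eventuallyEq (Eventually.of_forall fun r => ?_)
  simp only [Function.comp_apply, add_assoc, ← toTorus_add, ← Pi.single_add, add_sub_cancel]

lemma IsC1.continuous_pderiv {f : Torus d → F} (hf : IsC1 f) (i : Fin d) :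
    Continuous (pderiv i f) := by
  refine isOpenQuotientMap_toTorus.isQuotientMap.continuous_iff.2 ?_
  have : pderiv i f ∘ toTorus =
      fun y => fderiv ℝ (fun y : Fin d → ℝ => f (toTorus y)) y (Pi.single i 1) :=
    funext fun y => hf.pderiv_toTorus i y
  rw [this]
  exact (ContDiff.continuous_fderiv hf one_ne_zero).clm_apply continuous_const

lemma IsC1.apply {v : Torus d → Vec d} (hv : IsC1 v) (i : Fin d) : IsC1 (fun x => v x i) :=
  contDiff_euclidean.1 hv i

lemma IsC1.pderiv_apply {v : Torus d → Vec d} (hv : IsC1 v) (j i : Fin d) (x : Torus d) :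
    pderiv j v x i = pderiv j (fun x => v x i) x :=
  (((EuclideanSpace.proj i : Vec d →L[ℝ] ℝ).hasFDerivAt.comp_hasDerivAt (0 : ℝ)
    (hv.hasDerivAt j x)).deriv).symm

lemma IsC1.mul {f g : Torus d → ℝ} (hf : IsC1 f) (hg : IsC1 g) : IsC1 (fun x => f x * g x) :=
  ContDiff.mul hf hg

lemma IsC1.pderiv_mul {f g : Torus d → ℝ} (hf : IsC1 f) (hg : IsC1 g) (i : Fin d) (x : Torus d) :
    pderiv i (fun x => f x * g x) x = pderiv i f x * g x + f x * pderiv i g x := by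
  have := ((hf.hasDerivAt i x).fun_mul (hg.hasDerivAt i x)).deriv
  simpa only [toTorus_single_zero, add_zero, pderiv] using this

lemma IsC1.sum {ι : Type*} {s : Finset ι} {f : ι → Torus d → F} (hf : ∀ k ∈ s, IsC1 (f k)) :
    IsC1 (fun x => ∑ k ∈ s, f k x) :=
  ContDiff.sum hf

lemma IsC1.pderiv_sum {ι : Type*} {s : Finset ι} {f : ι → Torus d → F}
    (hf : ∀ k ∈ s, IsC1 (f k)) (i : Fin d) (x : Torus d) :
    pderiv i (fun x => ∑ k ∈ s, f k x) x = ∑ k ∈ s, pderiv i (f k) x :=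
  (HasDerivAt.fun_sum fun k hk => (hf k hk).hasDerivAt i x).deriv

lemma IsC1.const_mul {f : Torus d → ℝ} (hf : IsC1 f) (c : ℝ) : IsC1 (fun x => c * f x) :=
  ContDiff.mul contDiff_const hf

lemma IsC1.pderiv_const_mul {f : Torus d → ℝ} (hf : IsC1 f) (c : ℝ) (i : Fin d) (x : Torus d) :
    pderiv i (fun x => c * f x) x = c * pderiv i f x :=
  ((hf.hasDerivAt i x).const_mul c).deriv

lemma exists_norm_le_of_continuous {f : Torus d → ℝ} (hf : Continuous f) : ∃ C, ∀ x, ‖f x‖ ≤ C := by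
  obtain ⟨C, hC⟩ := isCompact_univ.exists_bound_of_continuousOn hf.continuousOn
  exact ⟨C, fun x => hC x (mem_univ x)⟩

lemma integrable_of_continuous {f : Torus d → ℝ} (hf : Continuous f) : Integrable f volume :=
  hf.integrable_of_hasCompactSupport (HasCompactSupport.of_compactSpace f)

/-- The integral of a partial derivative over the torus vanishes. -/
lemma IsC1.integral_pderiv {f : Torus d → ℝ} (hf : IsC1 f) (i : Fin d) :
    ∫ x, pderiv i f x = 0 := by
  obtain ⟨C, hC⟩ := exists_norm_le_of_continuous (hf.continuous_pderiv i)
  have hshift (s : ℝ) : Continuous fun x : Torus d => x + toTorus (Pi.single i s) :=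
    continuous_id.add continuous_const
  have h := (hasDerivAt_integral_of_dominated_loc_of_deriv_le (μ := (volume : Measure (Torus d)))
    (F := fun s x => f (x + toTorus (Pi.single i s)))
    (F' := fun s x => pderiv i f (x + toTorus (Pi.single i s)))
    (x₀ := (0 : ℝ)) (s := univ) (bound := fun _ => C) univ_mem
    (Eventually.of_forall fun s => (hf.continuous.comp (hshift s)).aestronglyMeasurable)
    (integrable_of_continuous (hf.continuous.comp (hshift 0)))
    ((hf.continuous_pderiv i).comp (hshift 0)).aestronglyMeasurable
    (Eventually.of_forall fun x s _ => hC _) (integrable_const C)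
    (Eventually.of_forall fun x s _ => hf.hasDerivAt_line i x s)).2
  -- By translation invariance the differentiated integral does not depend on the shift, so its
  -- derivative is zero.
  simp only [integral_add_right_eq_self, toTorus_single_zero, add_zero] at h
  exact h.unique (hasDerivAt_const _ _)

/-- Integration by parts on the torus. -/
lemma integral_pderiv_mul {f g : Torus d → ℝ} (hf : IsC1 f) (hg : IsC1 g) (i : Fin d) :
    ∫ x, pderiv i f x * g x = -∫ x, f x * pderiv i g x := by
  have h := (hf.mul hg).integral_pderiv i
  simp only [hf.pderiv_mul hg] at h
  rw [integral_add] at h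
  · linarith
  · exact integrable_of_continuous ((hf.continuous_pderiv i).mul hg.continuous)
  · exact integrable_of_continuous (hf.continuous.mul (hg.continuous_pderiv i))

/-! ### Trigonometric modes -/

lemma mFourier_toTorus (k : Fin d → ℤ) (y : Fin d → ℝ) :
    UnitAddTorus.mFourier k (toTorus y) =
      ∏ i, Complex.exp (2 * Real.pi * Complex.I * k i * y i) := by
  simp only [UnitAddTorus.mFourier, ContinuousMap.coe_mk]
  refine Finset.prod_congr rfl fun i _ => ?_
  rw [toTorus, fourier_coe_apply]
  simp

lemma mFourier_add_point (k : Fin d → ℤ) (x y : Torus d) :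
    UnitAddTorus.mFourier k (x + y) = UnitAddTorus.mFourier k x * UnitAddTorus.mFourier k y := by
  simp only [UnitAddTorus.mFourier, ContinuousMap.coe_mk, ← Finset.prod_mul_distrib, Pi.add_apply]
  refine Finset.prod_congr rfl fun i _ => ?_
  simp [fourier_apply, smul_add, AddCircle.toCircle_add]

lemma mFourier_neg_point (k : Fin d → ℤ) (x : Torus d) :
    UnitAddTorus.mFourier k (-x) = (starRingEnd ℂ) (UnitAddTorus.mFourier k x) := by
  rw [← UnitAddTorus.mFourier_neg]
  simp only [UnitAddTorus.mFourier, ContinuousMap.coe_mk]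
  refine Finset.prod_congr rfl fun i _ => ?_
  simp [fourier_apply]

lemma mFourier_toTorus_single (k : Fin d → ℤ) (i : Fin d) (s : ℝ) :
    UnitAddTorus.mFourier k (toTorus (Pi.single i s)) =
      Complex.exp ((s : ℂ) * (2 * Real.pi * Complex.I * k i)) := by
  rw [mFourier_toTorus, Finset.prod_eq_single i]
  · simp [mul_comm]
  · intro j _ hj
    simp [hj]
  · simp

lemma isC1_mFourier (k : Fin d → ℤ) : IsC1 (fun x : Torus d => UnitAddTorus.mFourier k x) := by
  unfold IsC1
  simp only [mFourier_toTorus]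
  refine contDiff_prod fun i _ => ContDiff.cexp (contDiff_const.mul ?_)
  exact Complex.ofRealCLM.contDiff.comp (contDiff_apply ℝ ℝ i)

lemma hasDerivAt_mFourier (k : Fin d → ℤ) (i : Fin d) (x : Torus d) :
    HasDerivAt (fun s : ℝ => UnitAddTorus.mFourier k (x + toTorus (Pi.single i s)))
      (UnitAddTorus.mFourier k x * (2 * Real.pi * Complex.I * k i)) 0 := by
  simp only [mFourier_add_point, mFourier_toTorus_single]
  refine HasDerivAt.const_mul _ ?_
  have h := ((Complex.ofRealCLM.hasDerivAt (x := (0 : ℝ))).mul_const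
    (2 * Real.pi * Complex.I * k i)).cexp
  simpa using h

/-- The real trigonometric modes: `cos (2π k · x)` for `(false, k)`, `sin (2π k · x)` for
`(true, k)`. -/
def trig (m : Bool × (Fin d → ℤ)) (x : Torus d) : ℝ :=
  if m.1 then (UnitAddTorus.mFourier m.2 x).im else (UnitAddTorus.mFourier m.2 x).re

lemma isC1_trig (m : Bool × (Fin d → ℤ)) : IsC1 (trig m) := by
  obtain ⟨b, k⟩ := m
  cases b
  · exact Complex.reCLM.contDiff.comp (isC1_mFourier k)
  · exact Complex.imCLM.contDiff.comp (isC1_mFourier k)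

lemma pderiv_trig_cos (k : Fin d → ℤ) (i : Fin d) (x : Torus d) :
    pderiv i (trig (false, k)) x = k i * (-(2 * Real.pi) * trig (true, k) x) := by
  have h := (Complex.reCLM.hasFDerivAt.comp_hasDerivAt (0 : ℝ) (hasDerivAt_mFourier k i x)).deriv
  refine h.trans ?_
  simp [trig]
  ring

lemma pderiv_trig_sin (k : Fin d → ℤ) (i : Fin d) (x : Torus d) :
    pderiv i (trig (true, k)) x = k i * ((2 * Real.pi) * trig (false, k) x) := by
  have h := (Complex.imCLM.hasFDerivAt.comp_hasDerivAt (0 : ℝ) (hasDerivAt_mFourier k i x)).deriv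
  refine h.trans ?_
  simp [trig]
  ring

/-- The gradient of a mode is parallel to its frequency. -/
lemma exists_pderiv_trig_eq (m : Bool × (Fin d → ℤ)) :
    ∃ g : Torus d → ℝ, ∀ i x, pderiv i (trig m) x = m.2 i * g x := by
  obtain ⟨b, k⟩ := m
  cases b
  · exact ⟨_, fun i x => pderiv_trig_cos k i x⟩
  · exact ⟨_, fun i x => pderiv_trig_sin k i x⟩

/-- A mode times its frequency is a gradient. -/
lemma exists_pderiv_eq_trig (m : Bool × (Fin d → ℤ)) :
    ∃ ψ : Torus d → ℝ, IsC1 ψ ∧ ∀ i x, pderiv i ψ x = m.2 i * trig m x := by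
  obtain ⟨b, k⟩ := m
  have hpi : (2 * Real.pi) ≠ 0 := by positivity
  cases b
  · refine ⟨_, (isC1_trig (true, k)).const_mul (2 * Real.pi)⁻¹, fun i x => ?_⟩
    rw [(isC1_trig (true, k)).pderiv_const_mul, pderiv_trig_sin]
    field_simp
  · refine ⟨_, (isC1_trig (false, k)).const_mul (-(2 * Real.pi)⁻¹), fun i x => ?_⟩
    rw [(isC1_trig (false, k)).pderiv_const_mul, pderiv_trig_cos]
    field_simp

lemma abs_trig_le_one (m : Bool × (Fin d → ℤ)) (x : Torus d) : |trig m x| ≤ 1 := by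
  have h : ‖UnitAddTorus.mFourier m.2 x‖ ≤ 1 :=
    (ContinuousMap.norm_coe_le_norm _ x).trans_eq UnitAddTorus.mFourier_norm
  unfold trig
  split_ifs
  · exact (Complex.abs_im_le_norm _).trans h
  · exact (Complex.abs_re_le_norm _).trans h

lemma trig_cos_sub (k : Fin d → ℤ) (x y : Torus d) :
    trig (false, k) (x - y) =
      trig (false, k) x * trig (false, k) y + trig (true, k) x * trig (true, k) y := by
  simp [trig, sub_eq_add_neg, mFourier_add_point, mFourier_neg_point]

lemma trig_cos_mul (k l : Fin d → ℤ) :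
    trig (false, k) * trig (false, l) =
      (1 / 2 : ℝ) • trig (false, k + l) + (1 / 2 : ℝ) • trig (false, k + -l) := by
  funext x
  simp [trig, UnitAddTorus.mFourier_add, UnitAddTorus.mFourier_neg]
  ring

/-! ### A trigonometric approximate identity -/

/-- A positive trigonometric polynomial with a strict maximum at the origin. -/
def bump (x : Torus d) : ℝ := 1 + ∑ i, (1 + trig (false, Pi.single i 1) x)

lemma continuous_bump : Continuous (bump : Torus d → ℝ) :=
  continuous_const.add (continuous_finsetSum _ fun _ _ =>
    continuous_const.add (isC1_trig _).continuous)

lemma bump_pos (x : Torus d) : 0 < bump x := by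
  have : 0 ≤ ∑ i : Fin d, (1 + trig (false, Pi.single i 1) x) :=
    Finset.sum_nonneg fun i _ => by
      linarith [neg_le_of_abs_le (abs_trig_le_one (false, Pi.single i 1) x)]
  unfold bump
  linarith

lemma bump_neg (x : Torus d) : bump (-x) = bump x := by
  simp [bump, trig, mFourier_neg_point]

lemma bump_zero : bump (0 : Torus d) = 1 + ∑ _i : Fin d, (1 + 1 : ℝ) := by
  simp [bump, trig, UnitAddTorus.mFourier]

/-- Some coordinate of `x` is nonzero, and its cosine is strictly below 1. Strictness makes the
powers of `bump` concentrate at the origin. -/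
lemma bump_lt {x : Torus d} (hx : x ≠ 0) : bump x < bump (0 : Torus d) := by
  rw [bump_zero, bump]
  obtain ⟨i, hi⟩ := Function.ne_iff.1 hx
  refine add_lt_add_right (Finset.sum_lt_sum (fun j _ => ?_) ⟨i, Finset.mem_univ i, ?_⟩) _
  · linarith [le_of_abs_le (abs_trig_le_one (false, Pi.single j 1) x)]
  · refine add_lt_add_right (lt_of_le_of_ne (le_of_abs_le (abs_trig_le_one _ x)) fun h => hi ?_) _
    simp only [trig, UnitAddTorus.mFourier_single, fourier_one] at h
    -- A point of the unit circle with real part 1 has zero imaginary part, hence is 1.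
    have h1 : AddCircle.toCircle (x i) = AddCircle.toCircle (0 : UnitAddCircle) := by
      rw [AddCircle.toCircle_zero]
      have hn : Complex.normSq (AddCircle.toCircle (x i) : ℂ) = 1 := Circle.normSq_coe _
      have hre : (AddCircle.toCircle (x i) : ℂ).re = 1 := by simpa using h
      ext
      rw [Complex.normSq_apply, hre] at hn
      refine Complex.ext (by simpa using hre) ?_
      simpa using (by nlinarith :
        (AddCircle.toCircle (x i) : ℂ).im * (AddCircle.toCircle (x i) : ℂ).im = 0)
    exact AddCircle.injective_toCircle one_ne_zero h1

/-- The product-to-sum formula makes the span of the cosines closed under multiplication. Every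
kernel therefore involves finitely many modes. -/
lemma bump_pow_mem_span (n : ℕ) :
    (bump : Torus d → ℝ) ^ n ∈
      Submodule.span ℝ (range fun k : Fin d → ℤ => trig (false, k)) := by
  set V := Submodule.span ℝ (range fun k : Fin d → ℤ => (trig (false, k) : Torus d → ℝ))
  have hmem (k : Fin d → ℤ) : trig (false, k) ∈ V := Submodule.subset_span ⟨k, rfl⟩
  have h1 : (1 : Torus d → ℝ) ∈ V := by
    have : (1 : Torus d → ℝ) = trig (false, 0) := by
      funext x
      simp [trig, UnitAddTorus.mFourier_zero]
    rw [this]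
    exact hmem 0
  have hVV : V * V ≤ V := by
    rw [Submodule.span_mul_span, Submodule.span_le]
    rintro _ ⟨_, ⟨k, rfl⟩, _, ⟨l, rfl⟩, rfl⟩
    simp only [trig_cos_mul]
    exact V.add_mem (V.smul_mem _ (hmem _)) (V.smul_mem _ (hmem _))
  have hb : (bump : Torus d → ℝ) ∈ V := by
    have : (bump : Torus d → ℝ) = 1 + ∑ i, (1 + trig (false, Pi.single i 1)) := by
      funext x
      simp [bump]
    rw [this]
    exact V.add_mem h1 (V.sum_mem fun i _ => V.add_mem h1 (hmem _))
  induction n with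
  | zero => simpa using h1
  | succ n ih => rw [pow_succ]; exact hVV (Submodule.mul_mem_mul ih hb)

/-- The mass of the `n`-th power of the bump. -/
def bumpMass (d n : ℕ) : ℝ := ∫ x : Torus d, bump x ^ n

lemma bumpMass_pos (d n : ℕ) : 0 < bumpMass d n :=
  (continuous_bump.pow n).integral_pos_of_hasCompactSupport_nonneg_nonzero
    (HasCompactSupport.of_compactSpace _) (fun x => (pow_pos (bump_pos x) n).le)
    (x := 0) (pow_pos (bump_pos _) n).ne'

/-- The approximate identity `bump ^ n / ∫ bump ^ n`. -/
def kernel (n : ℕ) (x : Torus d) : ℝ := (bumpMass d n)⁻¹ * bump x ^ n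

lemma continuous_kernel (n : ℕ) : Continuous (kernel n : Torus d → ℝ) :=
  continuous_const.mul (continuous_bump.pow n)

lemma kernel_nonneg (n : ℕ) (x : Torus d) : 0 ≤ kernel n x :=
  mul_nonneg (inv_nonneg.2 (bumpMass_pos d n).le) (pow_pos (bump_pos x) n).le

lemma kernel_sub_comm (n : ℕ) (x y : Torus d) : kernel n (x - y) = kernel n (y - x) := by
  rw [kernel, kernel, ← bump_neg, neg_sub]

lemma integral_kernel_sub (n : ℕ) (x : Torus d) : ∫ y, kernel n (x - y) = 1 := by
  simp only [kernel_sub_comm n x]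
  rw [integral_sub_right_eq_self (fun y => kernel n y) x]
  simp only [kernel]
  rw [integral_const_mul]
  exact inv_mul_cancel₀ (bumpMass_pos d n).ne'

/-- Normalised powers of a nonnegative continuous function with a unique maximum form a peak
sequence at that maximum. -/
lemma tendsto_integral_kernel {f : Torus d → ℝ} (hf : Continuous f) (x : Torus d) :
    Tendsto (fun n => ∫ y, kernel n (x - y) * f y) atTop (𝓝 (f x)) := by
  have h := tendsto_setIntegral_pow_smul_of_unique_maximum_of_isCompact_of_continuousOn
    (μ := (volume : Measure (Torus d))) (s := univ) (x₀ := x) (c := fun y => bump (x - y)) (g := f)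
    isCompact_univ (continuous_bump.comp (continuous_const.sub continuous_id)).continuousOn
    (fun y _ hy => by rw [sub_self]; exact bump_lt (sub_ne_zero.2 hy.symm))
    (fun y _ => (bump_pos _).le) (bump_pos _) (by simp) hf.continuousOn
  refine h.congr fun n => ?_
  have hmass : ∫ y, bump (x - y) ^ n = bumpMass d n := by
    have (y : Torus d) : bump (x - y) = bump (y - x) := by rw [← bump_neg, neg_sub]
    simp only [this]
    exact integral_sub_right_eq_self (fun y : Torus d => bump y ^ n) x
  simp only [Measure.restrict_univ, hmass, smul_eq_mul, kernel, mul_assoc, integral_const_mul]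

/-- The addition formula splits `cos (2πk · (x - y))` into a cosine and a sine product with the same
weight. The resulting bilinear form is diagonal in the modes, which later permits a product rule in
time for each mode separately. -/
lemma exists_kernel_eq_sum (n : ℕ) : ∃ (s : Finset (Bool × (Fin d → ℤ)))
    (a : Bool × (Fin d → ℤ) → ℝ), ∀ x y : Torus d,
      kernel n (x - y) = ∑ m ∈ s, a m * (trig m x * trig m y) := by
  obtain ⟨c, hc⟩ := Finsupp.mem_span_range_iff_exists_finsupp.1 (bump_pow_mem_span (d := d) n)
  refine ⟨Finset.univ ×ˢ c.support, fun m => (bumpMass d n)⁻¹ * c m.2, fun x y => ?_⟩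
  have h := congrFun hc (x - y)
  rw [kernel, ← Pi.pow_apply, ← h, Finset.sum_product, Fintype.sum_bool, Finsupp.sum,
    Finset.sum_apply, Finset.mul_sum, ← Finset.sum_add_distrib]
  refine Finset.sum_congr rfl fun k _ => ?_
  simp only [Pi.smul_apply, trig_cos_sub, smul_eq_mul]
  ring

/-! ### The mollified inner product -/

/-- The modes occurring in the `n`-th kernel. -/
def modes (d n : ℕ) : Finset (Bool × (Fin d → ℤ)) := (exists_kernel_eq_sum (d := d) n).choose

/-- The weights of the modes in the `n`-th kernel. -/
def weight (d n : ℕ) : Bool × (Fin d → ℤ) → ℝ :=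
  (exists_kernel_eq_sum (d := d) n).choose_spec.choose

lemma kernel_sub_eq_sum (n : ℕ) (x y : Torus d) :
    kernel n (x - y) = ∑ m ∈ modes d n, weight d n m * (trig m x * trig m y) :=
  (exists_kernel_eq_sum (d := d) n).choose_spec.choose_spec x y

/-- The (real) Fourier coefficient of `f` at the mode `m`. -/
def coef (m : Bool × (Fin d → ℤ)) (f : Torus d → ℝ) : ℝ := ∫ x, trig m x * f x

/-- The convolution of `f` with the `n`-th kernel. -/
def moll (n : ℕ) (f : Torus d → ℝ) (x : Torus d) : ℝ :=
  ∑ m ∈ modes d n, weight d n m * coef m f * trig m x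

/-- The inner product of `f` with the mollification of `g`. -/
def mollInner (n : ℕ) (f g : Torus d → ℝ) : ℝ :=
  ∑ m ∈ modes d n, weight d n m * (coef m f * coef m g)

lemma mollInner_comm (n : ℕ) (f g : Torus d → ℝ) : mollInner n f g = mollInner n g f := by
  simp only [mollInner, mul_comm]

lemma integrable_continuous_mul {f g : Torus d → ℝ} (hf : Continuous f)
    (hg : Integrable g volume) : Integrable (fun x => f x * g x) volume := by
  obtain ⟨C, hC⟩ := exists_norm_le_of_continuous hf
  exact hg.bdd_mul hf.aestronglyMeasurable (Eventually.of_forall hC)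

lemma integrable_trig_mul (m : Bool × (Fin d → ℤ)) {f : Torus d → ℝ}
    (hf : Integrable f volume) : Integrable (fun x => trig m x * f x) volume :=
  integrable_continuous_mul (isC1_trig m).continuous hf

lemma moll_eq_integral (n : ℕ) {f : Torus d → ℝ} (hf : Integrable f volume) (x : Torus d) :
    moll n f x = ∫ y, kernel n (x - y) * f y := by
  simp only [kernel_sub_eq_sum, Finset.sum_mul]
  rw [integral_finsetSum]
  · refine Finset.sum_congr rfl fun m _ => ?_
    rw [coef, mul_assoc, ← integral_mul_const, ← integral_const_mul]
    refine integral_congr_ae (Eventually.of_forall fun y => ?_)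
    simp only
    ring
  · intro m _
    refine ((integrable_trig_mul m hf).const_mul (weight d n m * trig m x)).congr
      (Eventually.of_forall fun y => ?_)
    simp only
    ring

lemma isC1_moll (n : ℕ) (f : Torus d → ℝ) : IsC1 (moll n f) :=
  IsC1.sum fun m _ => (isC1_trig m).const_mul _

lemma pderiv_moll (n : ℕ) (f : Torus d → ℝ) (i : Fin d) (x : Torus d) :
    pderiv i (moll n f) x = ∑ m ∈ modes d n, weight d n m * coef m f * pderiv i (trig m) x := by
  unfold moll
  rw [IsC1.pderiv_sum fun m _ => (isC1_trig m).const_mul _]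
  exact Finset.sum_congr rfl fun m _ => (isC1_trig m).pderiv_const_mul _ _ _

lemma integral_moll_mul (n : ℕ) (f : Torus d → ℝ) {g : Torus d → ℝ} (hg : Integrable g volume) :
    ∫ x, moll n f x * g x = mollInner n f g := by
  simp only [moll, Finset.sum_mul]
  rw [integral_finsetSum]
  · refine Finset.sum_congr rfl fun m _ => ?_
    simp only [mul_assoc]
    rw [integral_const_mul, integral_const_mul]
    rfl
  · intro m _
    simp only [mul_assoc]
    exact ((integrable_trig_mul m hg).const_mul _).const_mul _

lemma integrable_kernel_mul (n : ℕ) (x : Torus d) {f : Torus d → ℝ} (hf : Integrable f volume) :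
    Integrable (fun y => kernel n (x - y) * f y) volume :=
  integrable_continuous_mul ((continuous_kernel n).comp (continuous_const.sub continuous_id)) hf

lemma moll_one (n : ℕ) (x : Torus d) : moll n (fun _ => 1) x = 1 := by
  rw [moll_eq_integral n (integrable_const 1)]
  simpa using integral_kernel_sub n x

lemma abs_moll_le {n : ℕ} {f : Torus d → ℝ} {C : ℝ} (hf : Integrable f volume)
    (hC : ∀ x, |f x| ≤ C) (x : Torus d) : |moll n f x| ≤ C := by
  rw [moll_eq_integral n hf, ← Real.norm_eq_abs]
  refine (norm_integral_le_integral_norm _).trans ?_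
  calc ∫ y, ‖kernel n (x - y) * f y‖ ≤ ∫ y, kernel n (x - y) * C := by
        refine integral_mono (integrable_kernel_mul n x hf).norm
          (integrable_kernel_mul n x (integrable_const C)) fun y => ?_
        simp only [norm_mul, Real.norm_eq_abs, abs_of_nonneg (kernel_nonneg n _)]
        exact mul_le_mul_of_nonneg_left (hC y) (kernel_nonneg n _)
    _ = C := by rw [integral_mul_const, integral_kernel_sub, one_mul]

lemma abs_mollInner_le_of_bounded {n : ℕ} {f g : Torus d → ℝ} {C : ℝ}
    (hf : Integrable f volume) (hg : Integrable g volume) (hC : ∀ x, |f x| ≤ C) :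
    |mollInner n f g| ≤ C * ∫ x, |g x| := by
  rw [← integral_moll_mul n f hg, ← Real.norm_eq_abs, ← integral_const_mul]
  refine norm_integral_le_of_norm_le (hg.abs.const_mul C) (Eventually.of_forall fun x => ?_)
  rw [norm_mul]
  exact mul_le_mul_of_nonneg_right (abs_moll_le hf hC x) (abs_nonneg _)

/-- All the regularity is placed on `f`, whose mollifications stay within its sup bound, so
dominated convergence needs only integrability of `g`. This covers products of velocity components,
which are merely `L¹`. -/
lemma tendsto_mollInner {f g : Torus d → ℝ} (hf : Continuous f) (hg : Integrable g volume) :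
    Tendsto (fun n => mollInner n f g) atTop (𝓝 (∫ x, f x * g x)) := by
  obtain ⟨C, hC⟩ := exists_norm_le_of_continuous hf
  have hfi := integrable_of_continuous hf
  simp only [← integral_moll_mul _ f hg]
  refine tendsto_integral_of_dominated_convergence (fun x => C * ‖g x‖)
    (fun n => ((isC1_moll n f).continuous.aestronglyMeasurable).mul hg.aestronglyMeasurable)
    (hg.norm.const_mul C) (fun n => Eventually.of_forall fun x => ?_)
    (Eventually.of_forall fun x => ?_)
  · rw [norm_mul]
    exact mul_le_mul_of_nonneg_right (abs_moll_le hfi hC x) (norm_nonneg _)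
  · refine Tendsto.mul_const _ ?_
    simp only [moll_eq_integral _ hfi]
    exact tendsto_integral_kernel hf x

/-- Young's inequality is applied to `f y * g x` under a nonnegative kernel of unit mass, so the
bound is uniform in `n`. -/
lemma abs_mollInner_le {n : ℕ} {f g : Torus d → ℝ} (hf : MemLp f 2 volume)
    (hg : MemLp g 2 volume) :
    |mollInner n f g| ≤ ((∫ x, f x ^ 2) + ∫ x, g x ^ 2) / 2 := by
  have hfi := hf.integrable one_le_two
  have hgi := hg.integrable one_le_two
  have hf2 := hf.integrable_sq
  have hg2 := hg.integrable_sq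
  -- Mollification preserves integrals: pair with the constant 1, which it fixes, and use symmetry.
  have hmass : ∫ x, moll n (fun y => f y ^ 2) x = ∫ x, f x ^ 2 := by
    have h1 := integral_moll_mul n (fun y => f y ^ 2) (integrable_const (1 : ℝ))
    have h2 := integral_moll_mul n (fun _ : Torus d => (1 : ℝ)) hf2
    simp only [mul_one] at h1
    simp only [moll_one, one_mul] at h2
    rw [h1, mollInner_comm, h2]
  have hpt (x : Torus d) :
      ‖moll n f x * g x‖ ≤ (moll n (fun y => f y ^ 2) x + g x ^ 2) / 2 := by
    have hrhs : (moll n (fun y => f y ^ 2) x + g x ^ 2) / 2 =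
        ∫ y, kernel n (x - y) * ((f y ^ 2 + g x ^ 2) / 2) := by
      have : ∀ y, kernel n (x - y) * ((f y ^ 2 + g x ^ 2) / 2) =
          (kernel n (x - y) * f y ^ 2 + kernel n (x - y) * g x ^ 2) / 2 := fun y => by ring
      simp only [this]
      rw [integral_div, integral_add (integrable_kernel_mul n x hf2)
        (integrable_kernel_mul n x (integrable_const _)), integral_mul_const,
        integral_kernel_sub, one_mul, moll_eq_integral n hf2]
    rw [hrhs, moll_eq_integral n hfi, ← integral_mul_const]
    refine norm_integral_le_of_norm_le (integrable_kernel_mul n x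
      ((hf2.add (integrable_const _)).div_const 2)) (Eventually.of_forall fun y => ?_)
    rw [mul_assoc, norm_mul, Real.norm_of_nonneg (kernel_nonneg n _)]
    refine mul_le_mul_of_nonneg_left ?_ (kernel_nonneg n _)
    rw [Real.norm_eq_abs, abs_le]
    constructor <;> nlinarith [sq_nonneg (f y - g x), sq_nonneg (f y + g x)]
  rw [← integral_moll_mul n f hgi, ← Real.norm_eq_abs]
  have hmi : Integrable (fun x => moll n (fun y => f y ^ 2) x) volume :=
    integrable_of_continuous (isC1_moll n _).continuous
  refine (norm_integral_le_of_norm_le ((hmi.add hg2).div_const 2)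
    (Eventually.of_forall hpt)).trans_eq ?_
  simp only [Pi.add_apply]
  rw [integral_div, integral_add hmi hg2, hmass]

lemma coef_sub (m : Bool × (Fin d → ℤ)) {f g : Torus d → ℝ} (hf : Integrable f volume)
    (hg : Integrable g volume) : coef m (fun x => f x - g x) = coef m f - coef m g := by
  simp only [coef, mul_sub]
  exact integral_sub (integrable_trig_mul m hf) (integrable_trig_mul m hg)

lemma coef_const_mul (m : Bool × (Fin d → ℤ)) (c : ℝ) (f : Torus d → ℝ) :
    coef m (fun x => c * f x) = c * coef m f := by
  simp only [coef, mul_left_comm _ c]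
  exact integral_const_mul _ _

/-- A weighted Young inequality for the mollified inner product. -/
lemma abs_mollInner_le_weighted {n : ℕ} {f g : Torus d → ℝ} (hf : MemLp f 2 volume)
    (hg : MemLp g 2 volume) {δ : ℝ} (hδ : 0 < δ) :
    |mollInner n f g| ≤ (δ * (∫ x, f x ^ 2) + δ⁻¹ * ∫ x, g x ^ 2) / 2 := by
  have h := abs_mollInner_le (n := n) (hf.const_mul (√δ)) (hg.const_mul (√δ)⁻¹)
  have hs : √δ ≠ 0 := (Real.sqrt_pos.2 hδ).ne'
  have h1 : mollInner n (fun x => √δ * f x) (fun x => (√δ)⁻¹ * g x) = mollInner n f g := by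
    simp only [mollInner, coef_const_mul]
    refine Finset.sum_congr rfl fun m _ => ?_
    field_simp
  simp only [h1, mul_pow, integral_const_mul, inv_pow, Real.sq_sqrt hδ.le] at h
  exact h

lemma abs_integral_mul_le_weighted {f g : Torus d → ℝ} (hf : MemLp f 2 volume)
    (hg : MemLp g 2 volume) {δ : ℝ} (hδ : 0 < δ) :
    |∫ x, f x * g x| ≤ (δ * (∫ x, f x ^ 2) + δ⁻¹ * ∫ x, g x ^ 2) / 2 := by
  rw [← integral_const_mul, ← integral_const_mul, ← integral_add (hf.integrable_sq.const_mul _)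
    (hg.integrable_sq.const_mul _), ← integral_div, ← Real.norm_eq_abs]
  refine norm_integral_le_of_norm_le (((hf.integrable_sq.const_mul _).add
    (hg.integrable_sq.const_mul _)).div_const 2) (Eventually.of_forall fun x => ?_)
  have hs : 0 < √δ := Real.sqrt_pos.2 hδ
  have h1 : δ * f x ^ 2 = (√δ * f x) ^ 2 := by rw [mul_pow, Real.sq_sqrt hδ.le]
  have h2 : δ⁻¹ * g x ^ 2 = ((√δ)⁻¹ * g x) ^ 2 := by rw [mul_pow, inv_pow, Real.sq_sqrt hδ.le]
  have h3 : f x * g x = (√δ * f x) * ((√δ)⁻¹ * g x) := by field_simp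
  rw [h1, h2, h3, Real.norm_eq_abs, abs_le]
  set a := √δ * f x
  set b := (√δ)⁻¹ * g x
  constructor <;> nlinarith [sq_nonneg (a - b), sq_nonneg (a + b)]

/-- Needed for the initial datum, which is only `L²`: approximate one factor by a continuous `g` and
control the remainder uniformly in `n`. -/
lemma tendsto_mollInner_self {f : Torus d → ℝ} (hf : MemLp f 2 volume) :
    Tendsto (fun n => mollInner n f f) atTop (𝓝 (∫ x, f x ^ 2)) := by
  rw [Metric.tendsto_atTop]
  intro ε hε
  set A := ∫ x, f x ^ 2
  have hA : 0 ≤ A := integral_nonneg fun x => sq_nonneg _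
  -- With this weight `δ * A ≤ ε / 4`, while requiring the squared `L²` error to be at most `δ * (ε
  -- / 4)` leaves `ε / 4` after division by `δ`. The two remainders and the continuous part then
  -- total at most three quarters of `ε`.
  set δ := ε / (4 * (A + 1))
  have hδ : 0 < δ := by positivity
  obtain ⟨g, hg, hgL⟩ := MemLp.exists_boundedContinuous_integral_rpow_sub_le (p := 2) two_pos
    (by simpa using hf) (show 0 < δ * (ε / 4) by positivity)
  have hgL2 : MemLp g 2 (volume : Measure (Torus d)) := by simpa using hgL
  have hr : MemLp (fun x => f x - g x) 2 volume := hf.sub hgL2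
  have hrs : ∫ x, (f x - g x) ^ 2 ≤ δ * (ε / 4) := by simpa using hg
  have hfi := hf.integrable one_le_two
  have hgi := hgL2.integrable one_le_two
  obtain ⟨N, hN⟩ := Metric.tendsto_atTop.1 (tendsto_mollInner g.continuous hfi) (ε / 4)
    (by positivity)
  refine ⟨N, fun n hn => ?_⟩
  have h1 := abs_mollInner_le_weighted (n := n) hf hr hδ
  have h2 := abs_integral_mul_le_weighted hf hr hδ
  have h3 := hN n hn
  have hsmall : (δ * A + δ⁻¹ * ∫ x, (f x - g x) ^ 2) / 2 ≤ ε / 4 := by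
    have e1 : δ * A ≤ ε / 4 := by
      have : δ * (A + 1) = ε / 4 := by simp only [δ]; field_simp
      nlinarith
    have e2 : δ⁻¹ * ∫ x, (f x - g x) ^ 2 ≤ ε / 4 :=
      (mul_le_mul_of_nonneg_left hrs (inv_nonneg.2 hδ.le)).trans_eq (by field_simp)
    linarith
  have e1 : mollInner n f (fun x => f x - g x) = mollInner n f f - mollInner n g f := by
    rw [mollInner_comm n g f]
    simp only [mollInner, coef_sub _ hfi hgi, ← Finset.sum_sub_distrib]
    exact Finset.sum_congr rfl fun m _ => by ring
  have e2 : ∫ x, f x * (f x - g x) = A - ∫ x, g x * f x := by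
    have hgf : Integrable (fun x => g x * f x) volume := hgL2.integrable_mul hf
    rw [← integral_sub hf.integrable_sq hgf]
    exact integral_congr_ae (Eventually.of_forall fun x => by simp only; ring)
  rw [e1] at h1
  rw [e2] at h2
  rw [Real.dist_eq] at h3 ⊢
  rw [abs_le] at h1 h2
  rw [abs_lt] at h3 ⊢
  constructor <;> linarith [h1.1, h1.2, h2.1, h2.2, h3.1, h3.2]

/-! ### The stress term at a fixed time -/

/-- The `l`-th component of `∫ (v ⊗ v) ∇(trig m)`. -/
def stress (m : Bool × (Fin d → ℤ)) (l : Fin d) (v : Torus d → Vec d) : ℝ :=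
  ∑ j, ∫ x, pderiv j (trig m) x * (v x l * v x j)

lemma memLp_apply {v : Torus d → Vec d} (hv : MemLp v 2 volume) (i : Fin d) :
    MemLp (fun x => v x i) 2 volume :=
  (EuclideanSpace.proj i : Vec d →L[ℝ] ℝ).comp_memLp' hv

lemma integrable_apply_mul_apply {v w : Torus d → Vec d} (hv : MemLp v 2 volume)
    (hw : MemLp w 2 volume) (i j : Fin d) : Integrable (fun x => v x i * w x j) volume :=
  (memLp_apply hv i).integrable_mul (memLp_apply hw j)

/-- A mode times its frequency is a gradient, so it is an admissible test in the weak divergence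
condition. -/
lemma sum_freq_mul_coef {v : Torus d → Vec d} (hv : MemLp v 2 volume) (hdiv : IsWeaklyDivFree v)
    (m : Bool × (Fin d → ℤ)) : ∑ i, (m.2 i : ℝ) * coef m (fun x => v x i) = 0 := by
  obtain ⟨ψ, hψ, hm⟩ := exists_pderiv_eq_trig m
  have h := hdiv ψ hψ
  simp only [hm] at h
  rw [integral_finsetSum] at h
  · rw [← h]
    refine Finset.sum_congr rfl fun i _ => ?_
    rw [coef, ← integral_const_mul]
    exact integral_congr_ae (Eventually.of_forall fun x => by simp only; ring)
  · intro i _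
    refine ((integrable_trig_mul m ((memLp_apply hv i).integrable one_le_two)).const_mul
      (m.2 i : ℝ)).congr (Eventually.of_forall fun x => ?_)
    simp only
    ring

/-- The kernel depends on `x - y` only, so moving both points together in direction `j` gives
derivative zero. -/
lemma sum_pderiv_trig_mul (n : ℕ) (j : Fin d) (x y : Torus d) :
    ∑ m ∈ modes d n, weight d n m * (pderiv j (trig m) x * trig m y) =
      -∑ m ∈ modes d n, weight d n m * (trig m x * pderiv j (trig m) y) := by
  have h : HasDerivAt (fun s : ℝ => ∑ m ∈ modes d n, weight d n m *
      (trig m (x + toTorus (Pi.single j s)) * trig m (y + toTorus (Pi.single j s))))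
      (∑ m ∈ modes d n, weight d n m *
        (pderiv j (trig m) x * trig m y + trig m x * pderiv j (trig m) y)) 0 := by
    refine HasDerivAt.fun_sum fun m _ => HasDerivAt.const_mul _ ?_
    simpa only [toTorus_single_zero, add_zero] using
      ((isC1_trig m).hasDerivAt j x).fun_mul ((isC1_trig m).hasDerivAt j y)
  simp only [← kernel_sub_eq_sum, add_sub_add_right_eq_sub] at h
  have h0 := h.unique (hasDerivAt_const _ _)
  simp only [mul_add, Finset.sum_add_distrib] at h0
  linarith

/-- The derivative passes from `x` to `y` inside the kernel with a sign change, and integration by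
parts cancels that sign. -/
lemma pderiv_moll_of_isC1 (n : ℕ) {f : Torus d → ℝ} (hf : IsC1 f) (j : Fin d) (x : Torus d) :
    pderiv j (moll n f) x = moll n (pderiv j f) x := by
  have hfi := integrable_of_continuous hf.continuous
  have h1 : pderiv j (moll n f) x =
      ∫ y, ∑ m ∈ modes d n, weight d n m * (pderiv j (trig m) x * trig m y) * f y := by
    rw [pderiv_moll, integral_finsetSum]
    · refine Finset.sum_congr rfl fun m _ => ?_
      have : ∀ y, weight d n m * (pderiv j (trig m) x * trig m y) * f y =
          weight d n m * pderiv j (trig m) x * (trig m y * f y) := fun y => by ring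
      simp only [this]
      rw [integral_const_mul, coef]
      ring
    · intro m _
      refine ((integrable_trig_mul m hfi).const_mul
        (weight d n m * pderiv j (trig m) x)).congr (Eventually.of_forall fun y => ?_)
      simp only
      ring
  have hint (m : Bool × (Fin d → ℤ)) :
      Integrable (fun y => pderiv j (trig m) y * f y) volume :=
    integrable_continuous_mul ((isC1_trig m).continuous_pderiv j) hfi
  rw [h1]
  simp only [← Finset.sum_mul, sum_pderiv_trig_mul, neg_mul, integral_neg]
  simp only [Finset.sum_mul]
  rw [integral_finsetSum, moll, ← Finset.sum_neg_distrib]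
  · refine Finset.sum_congr rfl fun m _ => ?_
    have : ∀ y, weight d n m * (trig m x * pderiv j (trig m) y) * f y =
        weight d n m * trig m x * (pderiv j (trig m) y * f y) := fun y => by ring
    simp only [this]
    rw [integral_const_mul, integral_pderiv_mul (isC1_trig m) hf, coef]
    ring
  · intro m _
    refine ((hint m).const_mul (weight d n m * trig m x)).congr (Eventually.of_forall fun y => ?_)
    simp only
    ring

/-- Mollification preserves the divergence-free condition. -/
lemma sum_integral_moll_mul_pderiv (n : ℕ) {v : Torus d → Vec d} (hv : MemLp v 2 volume)
    (hdiv : IsWeaklyDivFree v) {ψ : Torus d → ℝ} (hψ : IsC1 ψ) :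
    ∑ l, ∫ x, moll n (fun y => v y l) x * pderiv l ψ x = 0 := by
  have h1 (l : Fin d) : ∫ x, moll n (fun y => v y l) x * pderiv l ψ x =
      -∑ m ∈ modes d n, weight d n m * coef m (fun y => v y l) * ∫ x, pderiv l (trig m) x * ψ x := by
    rw [integral_moll_mul n _ (integrable_of_continuous (hψ.continuous_pderiv l)), mollInner,
      ← Finset.sum_neg_distrib]
    refine Finset.sum_congr rfl fun m _ => ?_
    rw [integral_pderiv_mul (isC1_trig m) hψ, coef, coef]
    ring
  simp only [h1]
  rw [Finset.sum_neg_distrib, neg_eq_zero, Finset.sum_comm]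
  refine Finset.sum_eq_zero fun m _ => ?_
  -- The gradient of each mode is parallel to its frequency, to which the coefficient vector of `v`
  -- is orthogonal.
  obtain ⟨g, hg⟩ := exists_pderiv_trig_eq m
  have h2 (l : Fin d) : weight d n m * coef m (fun y => v y l) * ∫ x, pderiv l (trig m) x * ψ x =
      weight d n m * (∫ x, g x * ψ x) * (m.2 l * coef m (fun y => v y l)) := by
    simp only [hg, mul_assoc]
    rw [integral_const_mul]
    ring
  simp only [h2]
  rw [← Finset.mul_sum, sum_freq_mul_coef hv hdiv m, mul_zero]

lemma coef_symGrad {V : Torus d → Vec d} (hV : IsC1 V) (m : Bool × (Fin d → ℤ)) (l j : Fin d) :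
    coef m (fun x => symGrad V x l j) =
      (coef m (pderiv j fun x => V x l) + coef m (pderiv l fun x => V x j)) / 2 := by
  simp only [coef, symGrad, hV.pderiv_apply]
  rw [← integral_add, ← integral_div]
  · exact integral_congr_ae (Eventually.of_forall fun x => by simp only; ring)
  · exact integrable_trig_mul m (integrable_of_continuous ((hV.apply l).continuous_pderiv j))
  · exact integrable_trig_mul m (integrable_of_continuous ((hV.apply j).continuous_pderiv l))

lemma continuous_symGrad {V : Torus d → Vec d} (hV : IsC1 V) (l j : Fin d) :
    Continuous (fun x => symGrad V x l j) := by
  simp only [symGrad, hV.pderiv_apply]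
  exact (((hV.apply l).continuous_pderiv j).add ((hV.apply j).continuous_pderiv l)).div_const 2

lemma sum_weight_stress_mul_coef (n : ℕ) {v : Torus d → Vec d} (hv : MemLp v 2 volume)
    (f : Fin d → Torus d → ℝ) :
    ∑ m ∈ modes d n, weight d n m * ∑ l, stress m l v * coef m (f l) =
      ∑ l, ∑ j, ∫ x, pderiv j (moll n (f l)) x * (v x l * v x j) := by
  have hint (m : Bool × (Fin d → ℤ)) (l j : Fin d) :
      Integrable (fun x => pderiv j (trig m) x * (v x l * v x j)) volume :=
    integrable_continuous_mul ((isC1_trig m).continuous_pderiv j)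
      (integrable_apply_mul_apply hv hv l j)
  have h1 (l j : Fin d) : ∫ x, pderiv j (moll n (f l)) x * (v x l * v x j) =
      ∑ m ∈ modes d n, weight d n m * coef m (f l) *
        ∫ x, pderiv j (trig m) x * (v x l * v x j) := by
    simp only [pderiv_moll, Finset.sum_mul]
    rw [integral_finsetSum]
    · refine Finset.sum_congr rfl fun m _ => ?_
      rw [← integral_const_mul]
      exact integral_congr_ae (Eventually.of_forall fun x => by simp only; ring)
    · intro m _
      refine ((hint m l j).const_mul (weight d n m * coef m (f l))).congr
        (Eventually.of_forall fun x => by simp only; ring)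
  simp only [h1, stress, Finset.mul_sum, Finset.sum_mul]
  rw [Finset.sum_comm]
  refine Finset.sum_congr rfl fun l _ => ?_
  rw [Finset.sum_comm]
  refine Finset.sum_congr rfl fun j _ => Finset.sum_congr rfl fun m _ => by ring

/-- Since `v ⊗ v` is symmetric, the antisymmetric part of the gradient of `V` drops out. Only
`symGrad V` is controlled, so this removal is essential. -/
lemma sum_weight_stress_mul_coef_of_isC1 (n : ℕ) {v V : Torus d → Vec d} (hv : MemLp v 2 volume)
    (hV : IsC1 V) :
    ∑ m ∈ modes d n, weight d n m * ∑ l, stress m l v * coef m (fun x => V x l) =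
      ∑ l, ∑ j, mollInner n (fun x => symGrad V x l j) (fun x => v x l * v x j) := by
  rw [sum_weight_stress_mul_coef n hv]
  have h1 (l j : Fin d) : ∫ x, pderiv j (moll n fun x => V x l) x * (v x l * v x j) =
      mollInner n (pderiv j fun x => V x l) (fun x => v x l * v x j) := by
    simp only [pderiv_moll_of_isC1 n (hV.apply l)]
    exact integral_moll_mul n _ (integrable_apply_mul_apply hv hv l j)
  have h2 (l j : Fin d) : mollInner n (fun x => symGrad V x l j) (fun x => v x l * v x j) =
      (mollInner n (pderiv j fun x => V x l) (fun x => v x l * v x j) +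
        mollInner n (pderiv l fun x => V x j) (fun x => v x j * v x l)) / 2 := by
    simp only [mollInner, coef_symGrad hV, ← Finset.sum_add_distrib, Finset.sum_div,
      mul_comm (v _ j)]
    exact Finset.sum_congr rfl fun m _ => by ring
  simp only [h1, h2, ← Finset.sum_div, Finset.sum_add_distrib]
  rw [Finset.sum_comm (f := fun l j =>
    mollInner n (pderiv l fun x => V x j) (fun x => v x j * v x l))]
  ring

/-- The kinetic energy density is of class `C¹`, with gradient `∑ⱼ Vʲ ∂ᵢ Vʲ`. -/
lemma isC1_half_sum_sq {V : Torus d → Vec d} (hV : IsC1 V) :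
    IsC1 (fun x => (1 / 2 : ℝ) * ∑ j, V x j * V x j) :=
  (IsC1.sum fun j _ => (hV.apply j).mul (hV.apply j)).const_mul _

lemma pderiv_half_sum_sq {V : Torus d → Vec d} (hV : IsC1 V) (i : Fin d) (x : Torus d) :
    pderiv i (fun x => (1 / 2 : ℝ) * ∑ j, V x j * V x j) x =
      ∑ j, pderiv i (fun x => V x j) x * V x j := by
  rw [IsC1.pderiv_const_mul (IsC1.sum fun j _ => (hV.apply j).mul (hV.apply j)),
    IsC1.pderiv_sum fun j _ => (hV.apply j).mul (hV.apply j), Finset.mul_sum]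
  refine Finset.sum_congr rfl fun j _ => ?_
  rw [(hV.apply j).pderiv_mul (hV.apply j)]
  ring

/-- With `w` the mollification of `v`, incompressibility of `V` turns the left side into `-∫ w · (V
· ∇)V`. Subtracting `∫ w · ∇(|V|² / 2)`, which vanishes because `w` is solenoidal, completes the
full gradient to twice the symmetric one. -/
lemma sum_weight_coef_mul_stress_of_isC1 (n : ℕ) {v V : Torus d → Vec d} (hv : MemLp v 2 volume)
    (hvdiv : IsWeaklyDivFree v) (hV : IsC1 V) (hVL : MemLp V 2 volume)
    (hVdiv : IsWeaklyDivFree V) :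
    ∑ m ∈ modes d n, weight d n m * ∑ l, stress m l V * coef m (fun x => v x l) =
      -2 * ∑ l, ∑ j, mollInner n (fun x => v x l) (fun x => symGrad V x l j * V x j) := by
  rw [sum_weight_stress_mul_coef n hVL]
  set w : Fin d → Torus d → ℝ := fun l => moll n fun x => v x l
  have hw (l : Fin d) : IsC1 (w l) := isC1_moll n _
  have hc (l : Fin d) : Continuous (fun x => V x l) := (hV.apply l).continuous
  have hint {f : Torus d → ℝ} (hf : Continuous f) : Integrable f volume :=
    integrable_of_continuous hf
  have h1 (l : Fin d) : ∑ j, ∫ x, pderiv j (w l) x * (V x l * V x j) =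
      -∑ j, ∫ x, w l x * (pderiv j (fun x => V x l) x * V x j) := by
    -- The test function is the product of the `l`-th components of `w` and `V`.
    have h := hVdiv _ ((hw l).mul (hV.apply l))
    simp only [(hw l).pderiv_mul (hV.apply l)] at h
    rw [eq_neg_iff_add_eq_zero, ← Finset.sum_add_distrib, ← h, integral_finsetSum]
    · refine Finset.sum_congr rfl fun j _ => ?_
      rw [← integral_add]
      · exact integral_congr_ae (Eventually.of_forall fun x => by simp only; ring)
      · exact hint (((hw l).continuous_pderiv j).mul ((hc l).mul (hc j)))
      · exact hint ((hw l).continuous.mul (((hV.apply l).continuous_pderiv j).mul (hc j)))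
    · exact fun j _ => hint ((hc j).mul ((((hw l).continuous_pderiv j).mul (hc l)).add
        ((hw l).continuous.mul ((hV.apply l).continuous_pderiv j))))
  have h2 : ∑ l, ∑ j, ∫ x, w l x * (pderiv l (fun x => V x j) x * V x j) = 0 := by
    rw [← sum_integral_moll_mul_pderiv n hv hvdiv (isC1_half_sum_sq hV)]
    refine Finset.sum_congr rfl fun l _ => ?_
    simp only [pderiv_half_sum_sq hV]
    simp only [Finset.mul_sum]
    rw [integral_finsetSum]
    exact fun j _ => hint ((hw l).continuous.mul
      (((hV.apply j).continuous_pderiv l).mul (hc j)))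
  have h3 (l j : Fin d) :
      mollInner n (fun x => v x l) (fun x => symGrad V x l j * V x j) =
        ((∫ x, w l x * (pderiv j (fun x => V x l) x * V x j)) +
          ∫ x, w l x * (pderiv l (fun x => V x j) x * V x j)) / 2 := by
    have hSV : Integrable (fun x => symGrad V x l j * V x j) volume :=
      hint ((continuous_symGrad hV l j).mul (hc j))
    rw [← integral_moll_mul n _ hSV, ← integral_add, ← integral_div]
    · refine integral_congr_ae (Eventually.of_forall fun x => ?_)
      simp only [symGrad, hV.pderiv_apply, w]
      ring
    · exact hint ((hw l).continuous.mul (((hV.apply l).continuous_pderiv j).mul (hc j)))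
    · exact hint ((hw l).continuous.mul (((hV.apply j).continuous_pderiv l).mul (hc j)))
  change ∑ l, ∑ j, ∫ x, pderiv j (w l) x * (V x l * V x j) = _
  simp only [h1, h3, Finset.sum_neg_distrib, ← Finset.sum_div, Finset.sum_add_distrib]
  rw [h2]
  ring

/-- The integrand summed over `l` and `j` is `V · ∇(|V|² / 2)`, which integrates to zero for
solenoidal `V`. -/
lemma sum_integral_symGrad_mul_self {V : Torus d → Vec d} (hV : IsC1 V)
    (hVdiv : IsWeaklyDivFree V) :
    ∑ l, ∑ j, ∫ x, V x l * (symGrad V x l j * V x j) = 0 := by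
  have hc (l : Fin d) : Continuous (fun x => V x l) := (hV.apply l).continuous
  have h1 (l j : Fin d) : ∫ x, V x l * (symGrad V x l j * V x j) =
      ((∫ x, V x l * (pderiv l (fun x => V x j) x * V x j)) +
        ∫ x, V x j * (pderiv j (fun x => V x l) x * V x l)) / 2 := by
    rw [← integral_add, ← integral_div]
    · refine integral_congr_ae (Eventually.of_forall fun x => ?_)
      simp only [symGrad, hV.pderiv_apply]
      ring
    · exact integrable_of_continuous ((hc l).mul (((hV.apply j).continuous_pderiv l).mul (hc j)))
    · exact integrable_of_continuous ((hc j).mul (((hV.apply l).continuous_pderiv j).mul (hc l)))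
  have h2 : ∑ l, ∑ j, ∫ x, V x l * (pderiv l (fun x => V x j) x * V x j) = 0 := by
    have h := hVdiv _ (isC1_half_sum_sq hV)
    simp only [pderiv_half_sum_sq hV] at h
    simp only [Finset.mul_sum] at h
    have hi (l j : Fin d) :
        Integrable (fun x => V x l * (pderiv l (fun x => V x j) x * V x j)) volume :=
      integrable_of_continuous ((hc l).mul (((hV.apply j).continuous_pderiv l).mul (hc j)))
    rw [integral_finsetSum _ fun l _ => integrable_finsetSum _ fun j _ => hi l j] at h
    rw [← h]
    exact Finset.sum_congr rfl fun l _ => (integral_finsetSum _ fun j _ => hi l j).symm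
  simp only [h1, ← Finset.sum_div, Finset.sum_add_distrib]
  rw [Finset.sum_comm (f := fun l j => ∫ x, V x j * (pderiv j (fun x => V x l) x * V x l)), h2]
  norm_num

/-! ### Time integrals -/

lemma timeMeasure_eq_restrict_Ioc (T : ℝ) : timeMeasure T = volume.restrict (Ioc 0 T) :=
  Measure.restrict_congr_set Ioo_ae_eq_Ioc

instance (T : ℝ) : IsFiniteMeasure (timeMeasure T) := by
  unfold timeMeasure
  infer_instance

instance (d : ℕ) (T : ℝ) : IsFiniteMeasure (spaceTimeMeasure d T) := by
  unfold spaceTimeMeasure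
  infer_instance

lemma intervalIntegrable_iff_timeMeasure (hT : 0 ≤ T) {f : ℝ → ℝ} :
    IntervalIntegrable f volume 0 T ↔ Integrable f (timeMeasure T) := by
  rw [intervalIntegrable_iff_integrableOn_Ioc_of_le hT, timeMeasure_eq_restrict_Ioc, IntegrableOn]

lemma ae_uIoc_of_ae_timeMeasure {p : ℝ → Prop} (h : ∀ᵐ t ∂(timeMeasure T), p t) {a b : ℝ}
    (ha : a ∈ Icc 0 T) (hb : b ∈ Icc 0 T) : ∀ᵐ t, t ∈ uIoc a b → p t := by
  rw [timeMeasure_eq_restrict_Ioc, ae_restrict_iff' measurableSet_Ioc] at h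
  filter_upwards [h] with t ht hmem
  exact ht ⟨(le_min ha.1 hb.1).trans_lt hmem.1, hmem.2.trans (max_le ha.2 hb.2)⟩

lemma intervalIntegrable_of_mem {f : ℝ → ℝ} (hf : IntervalIntegrable f volume 0 T) {a b : ℝ}
    (ha : a ∈ Icc 0 T) (hb : b ∈ Icc 0 T) : IntervalIntegrable f volume a b := by
  have hT : 0 ≤ T := ha.1.trans ha.2
  refine hf.mono_set ?_
  rw [uIcc_of_le hT]
  exact uIcc_subset_Icc ha hb

lemma continuousOn_integral {f : ℝ → ℝ} (hT : 0 ≤ T) (hf : IntervalIntegrable f volume 0 T) :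
    ContinuousOn (fun s => ∫ t in (0 : ℝ)..s, f t) (Icc 0 T) := by
  rw [← uIcc_of_le hT]
  exact intervalIntegral.continuousOn_primitive_interval' hf left_mem_uIcc

/-- The product rule for primitives of integrable functions. -/
lemma mul_primitive_eq {F G : ℝ → ℝ} (hF : IntervalIntegrable F volume 0 T)
    (hG : IntervalIntegrable G volume 0 T) (a b : ℝ) {τ : ℝ} (hτ : τ ∈ Icc 0 T) :
    (a + ∫ t in (0 : ℝ)..τ, F t) * (b + ∫ t in (0 : ℝ)..τ, G t) = a * b +
      ∫ t in (0 : ℝ)..τ, (F t * (b + ∫ s in (0 : ℝ)..t, G s) +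
        (a + ∫ s in (0 : ℝ)..t, F s) * G t) := by
  have h0 : (0 : ℝ) ∈ Icc 0 T := ⟨le_rfl, hτ.1.trans hτ.2⟩
  replace hF := intervalIntegrable_of_mem hF h0 hτ
  replace hG := intervalIntegrable_of_mem hG h0 hτ
  have hconst (c : ℝ) : AbsolutelyContinuousOnInterval (fun _ : ℝ => c) 0 τ :=
    (LipschitzWith.const c).lipschitzOnWith.absolutelyContinuousOnInterval
  have hFac := (hconst a).fun_add
    (hF.absolutelyContinuousOnInterval_intervalIntegral (c := 0) left_mem_uIcc)
  have hGac := (hconst b).fun_add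
    (hG.absolutelyContinuousOnInterval_intervalIntegral (c := 0) left_mem_uIcc)
  have h := hFac.integral_deriv_mul_eq_sub hGac
  simp only [intervalIntegral.integral_same, add_zero] at h
  rw [eq_comm, ← eq_sub_iff_add_eq', ← h]
  refine intervalIntegral.integral_congr_ae ?_
  filter_upwards [hF.ae_hasDerivAt_integral, hG.ae_hasDerivAt_integral] with t hFt hGt ht
  have ht' := uIoc_subset_uIcc ht
  rw [((hFt ht' 0 left_mem_uIcc).const_add a).deriv, ((hGt ht' 0 left_mem_uIcc).const_add b).deriv]

lemma intervalIntegrable_mul_primitive {F G : ℝ → ℝ} (hT : 0 ≤ T)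
    (hF : IntervalIntegrable F volume 0 T)
    (hG : IntervalIntegrable G volume 0 T) (b : ℝ) :
    IntervalIntegrable (fun t => F t * (b + ∫ s in (0 : ℝ)..t, G s)) volume 0 T := by
  refine hF.mul_continuousOn ?_
  rw [uIcc_of_le hT]
  exact continuousOn_const.add (continuousOn_integral hT hG)

/-- Grönwall's inequality with an integrable coefficient and zero initial value. -/
lemma ae_eq_zero_of_le_integral (hT : 0 ≤ T) {E G : ℝ → ℝ} (hE : ∀ t, 0 ≤ E t)
    (hG : ∀ t, 0 ≤ G t) (hGi : Integrable G (timeMeasure T))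
    (hGE : Integrable (fun t => G t * E t) (timeMeasure T))
    (h : ∀ᵐ τ ∂(timeMeasure T), E τ ≤ ∫ t in (0 : ℝ)..τ, G t * E t) :
    ∀ᵐ τ ∂(timeMeasure T), E τ = 0 := by
  rw [← intervalIntegrable_iff_timeMeasure hT] at hGi hGE
  set F : ℝ → ℝ := fun τ => ∫ t in (0 : ℝ)..τ, G t * E t
  set A : ℝ → ℝ := fun τ => ∫ t in (0 : ℝ)..τ, G t
  have h0 : (0 : ℝ) ∈ Icc 0 T := ⟨le_rfl, hT⟩
  have hFc : ContinuousOn F (Icc 0 T) := continuousOn_integral hT hGE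
  have hAc : ContinuousOn A (Icc 0 T) := continuousOn_integral hT hGi
  have hFsub {s τ : ℝ} (hs : s ∈ Icc 0 T) (hτ : τ ∈ Icc 0 T) :
      F τ - F s = ∫ t in s..τ, G t * E t :=
    intervalIntegral.integral_interval_sub_left (intervalIntegrable_of_mem hGE h0 hτ)
      (intervalIntegrable_of_mem hGE h0 hs)
  have hAsub {s τ : ℝ} (hs : s ∈ Icc 0 T) (hτ : τ ∈ Icc 0 T) : A τ - A s = ∫ t in s..τ, G t :=
    intervalIntegral.integral_interval_sub_left (intervalIntegrable_of_mem hGi h0 hτ)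
      (intervalIntegrable_of_mem hGi h0 hs)
  have hmono {s τ : ℝ} (hs : s ∈ Icc 0 T) (hτ : τ ∈ Icc 0 T) (hsτ : s ≤ τ) : F s ≤ F τ := by
    rw [← sub_nonneg, hFsub hs hτ]
    exact intervalIntegral.integral_nonneg hsτ fun t _ => mul_nonneg (hG t) (hE t)
  -- On `[s, τ]` almost every `E t` is at most `F t ≤ F τ`, which comes out of the integral.
  have hstep {s τ : ℝ} (hs : s ∈ Icc 0 T) (hτ : τ ∈ Icc 0 T) (hsτ : s ≤ τ) :
      F τ - F s ≤ F τ * (A τ - A s) := by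
    rw [hFsub hs hτ, hAsub hs hτ, ← intervalIntegral.integral_const_mul]
    refine intervalIntegral.integral_mono_ae_restrict hsτ (intervalIntegrable_of_mem hGE hs hτ)
      ((intervalIntegrable_of_mem hGi hs hτ).const_mul _) ?_
    have hae := ae_uIoc_of_ae_timeMeasure h hs hτ
    rw [uIoc_of_le hsτ, ← ae_restrict_iff' measurableSet_Ioc, 
      Measure.restrict_congr_set Ioc_ae_eq_Icc] at hae
    filter_upwards [hae, ae_restrict_mem measurableSet_Icc] with t ht htm
    rw [mul_comm]
    exact mul_le_mul_of_nonneg_right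
      (ht.trans (hmono ⟨hs.1.trans htm.1, htm.2.trans hτ.2⟩ hτ htm.2)) (hG t)
  -- Continuous induction: the zero set of `F` is closed and contains 0. It extends to the right of
  -- any of its points `x`, since `F z ≤ F z * (A z - A x)` with `A z - A x < 1` forces `F z = 0`.
  have hzero : Icc 0 T ⊆ {τ | F τ = 0} := by
    refine IsClosed.Icc_subset_of_forall_exists_gt ?_ (intervalIntegral.integral_same) ?_
    · rw [inter_comm]
      exact hFc.preimage_isClosed_of_isClosed isClosed_Icc isClosed_singleton
    · rintro x ⟨hx0, hx⟩ y hy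
      have hxm : x ∈ Icc 0 T := ⟨hx.1, hx.2.le⟩
      have hev : ∀ᶠ z in 𝓝[>] x, A z < A x + 1 := by
        have hcw : ContinuousWithinAt A (Ioc x T) x :=
          (hAc x hxm).mono fun z hz => ⟨hx.1.trans hz.1.le, hz.2⟩
        rw [← nhdsWithin_Ioc_eq_nhdsGT hx.2]
        exact hcw.eventually (gt_mem_nhds (by linarith))
      have hIoc : ∀ᶠ z in 𝓝[>] x, z ∈ Ioc x (min y T) :=
        Ioc_mem_nhdsGT (lt_min hy hx.2)
      obtain ⟨z, hz1, hz2⟩ := (hev.and hIoc).exists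
      have hzm : z ∈ Icc 0 T := ⟨hx.1.trans hz2.1.le, hz2.2.trans (min_le_right _ _)⟩
      refine ⟨z, ?_, hz2.1, hz2.2.trans (min_le_left _ _)⟩
      have h1 := hstep hxm hzm hz2.1.le
      have h2 := hmono hxm hzm hz2.1.le
      rw [show F x = 0 from hx0] at h1 h2
      refine le_antisymm ?_ h2
      nlinarith
  filter_upwards [h, ae_restrict_mem measurableSet_Ioo] with τ hτ hm
  exact le_antisymm (hτ.trans_eq (hzero ⟨hm.1.le, hm.2.le⟩)) (hE τ)

/-! ### Slices of space-time functions -/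

lemma ae_memLp_slice {v : ℝ → Torus d → Vec d}
    (hv : MemLp (Function.uncurry v) 2 (spaceTimeMeasure d T)) :
    ∀ᵐ t ∂(timeMeasure T), MemLp (v t) 2 volume := by
  have h1 : ∀ᵐ t ∂(timeMeasure T), AEStronglyMeasurable (v t) volume :=
    hv.aestronglyMeasurable.prodMk_left
  have h2 : Integrable (fun z : ℝ × Torus d => ‖v z.1 z.2‖ ^ 2) ((timeMeasure T).prod volume) :=
    (memLp_two_iff_integrable_sq_norm hv.aestronglyMeasurable).1 hv
  filter_upwards [h1, h2.prod_right_ae] with t ht1 ht2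
  exact (memLp_two_iff_integrable_sq_norm ht1).2 ht2

lemma memLp_uncurry_apply {v : ℝ → Torus d → Vec d}
    (hv : MemLp (Function.uncurry v) 2 (spaceTimeMeasure d T)) (i : Fin d) :
    MemLp (fun z : ℝ × Torus d => v z.1 z.2 i) 2 ((timeMeasure T).prod volume) :=
  (EuclideanSpace.proj i : Vec d →L[ℝ] ℝ).comp_memLp' hv

lemma integrable_stress {v : ℝ → Torus d → Vec d}
    (hv : MemLp (Function.uncurry v) 2 (spaceTimeMeasure d T)) (m : Bool × (Fin d → ℤ))
    (l : Fin d) : Integrable (fun t => stress m l (v t)) (timeMeasure T) := by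
  refine integrable_finsetSum _ fun j _ => ?_
  have h1 : Integrable (fun z : ℝ × Torus d => v z.1 z.2 l * v z.1 z.2 j)
      ((timeMeasure T).prod volume) :=
    (memLp_uncurry_apply hv l).integrable_mul (memLp_uncurry_apply hv j)
  have hc := (isC1_trig m).continuous_pderiv j
  obtain ⟨C, hC⟩ := exists_norm_le_of_continuous hc
  have h2 : Integrable (fun z : ℝ × Torus d =>
      pderiv j (trig m) z.2 * (v z.1 z.2 l * v z.1 z.2 j)) ((timeMeasure T).prod volume) :=
    h1.bdd_mul (hc.comp continuous_snd).aestronglyMeasurable (Eventually.of_forall fun z => hC _)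
  exact h2.integral_prod_left

lemma integrable_integral_norm_sq {v : ℝ → Torus d → Vec d}
    (hv : MemLp (Function.uncurry v) 2 (spaceTimeMeasure d T)) :
    Integrable (fun t => ∫ x, ‖v t x‖ ^ 2) (timeMeasure T) := by
  have h2 : Integrable (fun z : ℝ × Torus d => ‖v z.1 z.2‖ ^ 2) ((timeMeasure T).prod volume) :=
    (memLp_two_iff_integrable_sq_norm hv.aestronglyMeasurable).1 hv
  exact h2.integral_prod_left

lemma MemLpLq.exists_ae_integral_le {v : ℝ → Torus d → Vec d}
    (hv : MemLp (Function.uncurry v) 2 (spaceTimeMeasure d T)) (h : MemLpLq ∞ 2 T v) :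
    ∃ M, ∀ᵐ t ∂(timeMeasure T), ∫ x, ‖v t x‖ ^ 2 ≤ M := by
  have hlt := h.norm_lt_top
  rw [eLpNorm_exponent_top] at hlt
  refine ⟨(eLpNormEssSup (fun t => eLpNorm (v t) 2 volume) (timeMeasure T)).toReal ^ 2, ?_⟩
  filter_upwards [ae_le_eLpNormEssSup (f := fun t => eLpNorm (v t) 2 volume)
    (μ := timeMeasure T), ae_memLp_slice hv] with t ht hm
  have h1 : ∫ x, ‖v t x‖ ^ 2 = (eLpNorm (v t) 2 volume).toReal ^ 2 := by
    have h0 : 0 ≤ ∫ x, ‖v t x‖ ^ 2 := integral_nonneg fun x => sq_nonneg _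
    rw [hm.eLpNorm_eq_integral_rpow_norm two_ne_zero ENNReal.ofNat_ne_top]
    simp only [ENNReal.toReal_ofNat, Real.rpow_two]
    rw [ENNReal.toReal_ofReal (Real.rpow_nonneg h0 _), ← Real.rpow_natCast, ← Real.rpow_mul h0]
    norm_num
  rw [h1]
  exact pow_le_pow_left₀ ENNReal.toReal_nonneg (ENNReal.toReal_mono hlt.ne (by simpa using ht)) 2

/-- The supremum norm of the symmetric gradient. -/
def symGradNorm (V : Torus d → Vec d) : ℝ := (eLpNorm (symGrad V) ∞ volume).toReal

lemma MemLpLq.integrable_symGradNorm {V : ℝ → Torus d → Vec d}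
    (h : MemLpLq 1 ∞ T (fun t => symGrad (V t))) :
    Integrable (fun t => symGradNorm (V t)) (timeMeasure T) := by
  have hlt := h.norm_lt_top
  rw [eLpNorm_one_eq_lintegral_enorm] at hlt
  exact integrable_toReal_of_lintegral_ne_top h.aemeasurable_norm (by simpa using hlt.ne)

/-- The essential bound holds everywhere: its failure set is open by continuity, and a null open
subset of the torus is empty. -/
lemma abs_symGrad_le_symGradNorm {V : Torus d → Vec d} (hV : IsC1 V)
    (h : eLpNorm (symGrad V) ∞ volume < ∞) (l j : Fin d) (x : Torus d) :
    |symGrad V x l j| ≤ symGradNorm V := by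
  have hae : ∀ᵐ x, |symGrad V x l j| ≤ symGradNorm V := by
    rw [eLpNorm_exponent_top] at h
    filter_upwards [ae_le_eLpNormEssSup (f := symGrad V) (μ := volume)] with x hx
    have h1 : ‖symGrad V x‖ ≤ symGradNorm V := by
      rw [symGradNorm, eLpNorm_exponent_top, ← toReal_enorm]
      exact ENNReal.toReal_mono h.ne hx
    exact ((norm_le_pi_norm (symGrad V x l) j).trans (norm_le_pi_norm (symGrad V x) l)).trans h1
  have hopen : IsOpen {x | symGradNorm V < |symGrad V x l j|} :=
    isOpen_lt continuous_const (continuous_symGrad hV l j).abs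
  have hempty : {x | symGradNorm V < |symGrad V x l j|} = ∅ := by
    rw [← hopen.measure_eq_zero_iff volume]
    simpa only [ae_iff, not_le] using hae
  by_contra hx
  exact (hempty ▸ (show x ∈ {x | symGradNorm V < |symGrad V x l j|} from not_le.1 hx) :
    x ∈ (∅ : Set (Torus d)))

lemma MemLpLq.ae_abs_symGrad_le {V : ℝ → Torus d → Vec d}
    (h : MemLpLq 1 ∞ T (fun t => symGrad (V t))) (hV : ∀ᵐ t ∂(timeMeasure T), IsC1 (V t)) :
    ∀ᵐ t ∂(timeMeasure T), ∀ l j x, |symGrad (V t) x l j| ≤ symGradNorm (V t) := by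
  have hlt := h.norm_lt_top
  rw [eLpNorm_one_eq_lintegral_enorm] at hlt
  filter_upwards [hV, ae_lt_top' h.aemeasurable_norm (by simpa using hlt.ne)] with t ht1 ht2
  exact fun l j x => abs_symGrad_le_symGradNorm ht1 ht2 l j x

/-! ### Evolution of the Fourier modes -/

/-- The orthogonal projection onto the complement of a frequency. -/
def freqProj (k : Fin d → ℤ) (i l : Fin d) : ℝ :=
  (if i = l then 1 else 0) - k i * k l / ∑ j, (k j : ℝ) ^ 2

lemma sum_freqProj_mul (k : Fin d → ℤ) (p : Fin d → ℝ) (i : Fin d) :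
    ∑ l, freqProj k i l * p l = p i - k i * (∑ l, k l * p l) / ∑ j, (k j : ℝ) ^ 2 := by
  simp only [freqProj, sub_mul, Finset.sum_sub_distrib, ite_mul, one_mul, zero_mul,
    Finset.sum_ite_eq, Finset.mem_univ, if_true, Finset.mul_sum, Finset.sum_div]
  congr 1
  exact Finset.sum_congr rfl fun l _ => by ring

lemma freqProj_comm (k : Fin d → ℤ) (i l : Fin d) : freqProj k i l = freqProj k l i := by
  simp only [freqProj, eq_comm, mul_comm]

lemma sum_freqProj_mul_freq (k : Fin d → ℤ) (i : Fin d) : ∑ l, freqProj k i l * k l = 0 := by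
  rw [sum_freqProj_mul k (fun l => (k l : ℝ))]
  have h : ∑ l, (k l : ℝ) * k l = ∑ j, (k j : ℝ) ^ 2 :=
    Finset.sum_congr rfl fun l _ => (sq _).symm
  rw [h]
  -- At frequency zero the convention `x / 0 = 0` makes `freqProj` the identity, as it should be:
  -- constant fields are solenoidal.
  by_cases h0 : ∑ j, (k j : ℝ) ^ 2 = 0
  · have hk : (k i : ℝ) = 0 := by
      have := (Finset.sum_eq_zero_iff_of_nonneg fun j _ => sq_nonneg (k j : ℝ)).1 h0 i
        (Finset.mem_univ i)
      exact pow_eq_zero_iff two_ne_zero |>.1 this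
    simp [hk]
  · rw [mul_div_assoc, div_self h0]
    ring

/-- The solenoidal part of the stress at a mode. -/
def projStress (m : Bool × (Fin d → ℤ)) (i : Fin d) (v : Torus d → Vec d) : ℝ :=
  ∑ l, freqProj m.2 i l * stress m l v

/-- The projection is symmetric, so it can be moved to the coefficients of `w`, on which it acts
trivially because they are orthogonal to the frequency. -/
lemma sum_projStress_mul_coef (m : Bool × (Fin d → ℤ)) (v : Torus d → Vec d)
    {w : Torus d → Vec d} (hw : MemLp w 2 volume) (hdiv : IsWeaklyDivFree w) :
    ∑ i, projStress m i v * coef m (fun x => w x i) =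
      ∑ l, stress m l v * coef m (fun x => w x l) := by
  simp only [projStress, Finset.sum_mul]
  rw [Finset.sum_comm]
  refine Finset.sum_congr rfl fun l _ => ?_
  have h : ∑ i, freqProj m.2 i l * stress m l v * coef m (fun x => w x i) =
      stress m l v * ∑ i, freqProj m.2 l i * coef m (fun x => w x i) := by
    rw [Finset.mul_sum]
    exact Finset.sum_congr rfl fun i _ => by rw [freqProj_comm m.2 i l]; ring
  rw [h, sum_freqProj_mul, sum_freq_mul_coef hw hdiv m]
  simp

/-- A mode times a constant vector, as a test field independent of time. -/
def modeField (m : Bool × (Fin d → ℤ)) (a : Fin d → ℝ) (x : Torus d) : Vec d :=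
  WithLp.toLp 2 fun i => a i * trig m x

lemma isC1_modeField (m : Bool × (Fin d → ℤ)) (a : Fin d → ℝ) : IsC1 (modeField m a) :=
  contDiff_euclidean.2 fun i => (isC1_trig m).const_mul (a i)

lemma pderiv_modeField (m : Bool × (Fin d → ℤ)) (a : Fin d → ℝ) (j i : Fin d) (x : Torus d) :
    pderiv j (modeField m a) x i = a i * pderiv j (trig m) x := by
  rw [(isC1_modeField m a).pderiv_apply]
  exact (isC1_trig m).pderiv_const_mul _ _ _

lemma divergence_modeField (m : Bool × (Fin d → ℤ)) {a : Fin d → ℝ}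
    (ha : ∑ i, a i * m.2 i = 0) (x : Torus d) : divergence (modeField m a) x = 0 := by
  obtain ⟨g, hg⟩ := exists_pderiv_trig_eq m
  simp only [divergence, pderiv_modeField, hg, ← mul_assoc]
  rw [← Finset.sum_mul, ha, zero_mul]

lemma integral_sum_mul_modeField {v : Torus d → Vec d} (hv : MemLp v 2 volume)
    (m : Bool × (Fin d → ℤ)) (a : Fin d → ℝ) :
    Integrable (fun x => ∑ i, v x i * modeField m a x i) volume ∧
      ∫ x, ∑ i, v x i * modeField m a x i = ∑ i, a i * coef m (fun x => v x i) := by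
  have h1 (x : Torus d) (i : Fin d) :
      v x i * modeField m a x i = a i * (trig m x * v x i) := by
    simp only [modeField]
    ring
  have h2 (i : Fin d) : Integrable (fun x => a i * (trig m x * v x i)) volume :=
    (integrable_trig_mul m ((memLp_apply hv i).integrable one_le_two)).const_mul _
  simp only [h1]
  refine ⟨integrable_finsetSum _ fun i _ => h2 i, ?_⟩
  rw [integral_finsetSum _ fun i _ => h2 i]
  exact Finset.sum_congr rfl fun i _ => integral_const_mul _ _

lemma integral_sum_pderiv_modeField {v : Torus d → Vec d} (hv : MemLp v 2 volume)
    (m : Bool × (Fin d → ℤ)) (a : Fin d → ℝ) :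
    ∫ x, ∑ i, ∑ j, pderiv j (modeField m a) x i * (v x i * v x j) =
      ∑ i, a i * stress m i v := by
  have h2 (i j : Fin d) :
      Integrable (fun x => a i * (pderiv j (trig m) x * (v x i * v x j))) volume :=
    (integrable_continuous_mul ((isC1_trig m).continuous_pderiv j)
      (integrable_apply_mul_apply hv hv i j)).const_mul _
  simp only [pderiv_modeField, mul_assoc]
  rw [integral_finsetSum _ fun i _ => integrable_finsetSum _ fun j _ => h2 i j]
  refine Finset.sum_congr rfl fun i _ => ?_
  rw [integral_finsetSum _ fun j _ => h2 i j, stress, Finset.mul_sum]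
  exact Finset.sum_congr rfl fun j _ => integral_const_mul _ _

/-- The modes of a weak solution are primitives of the solenoidal part of the stress. -/
lemma IsWeakSolution.ae_coef_eq {u₀ : Torus d → Vec d} {u : ℝ → Torus d → Vec d}
    (hu : IsWeakSolution T u₀ u) (hu₀ : MemLp u₀ 2 volume) (hu₀_div : IsWeaklyDivFree u₀) :
    ∀ᵐ τ ∂(timeMeasure T), ∀ (m : Bool × (Fin d → ℤ)) (i : Fin d),
      coef m (fun x => u τ x i) = coef m (fun x => u₀ x i) +
        ∫ t in (0 : ℝ)..τ, projStress m i (u t) := by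
  have hslice := ae_memLp_slice hu.memLp
  filter_upwards [hu.momentum, hslice, hu.divFree, ae_restrict_mem measurableSet_Ioo]
    with τ hmom hτL hτdiv hτ m i
  -- The test amplitude is a row of the projection, hence orthogonal to the frequency, so the field
  -- is solenoidal. The exceptional null set of times is independent of the test field and serves
  -- all modes at once.
  have h := hmom (fun _ => modeField m (freqProj m.2 i))
    (ContDiff.comp (g := fun y : Fin d → ℝ => modeField m (freqProj m.2 i) (toTorus y))
      (isC1_modeField m (freqProj m.2 i)) contDiff_snd)
    (fun t _ x => divergence_modeField m (sum_freqProj_mul_freq m.2 i) x)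
  obtain ⟨hi1, he1⟩ := integral_sum_mul_modeField hτL m (freqProj m.2 i)
  obtain ⟨hi2, he2⟩ := integral_sum_mul_modeField hu₀ m (freqProj m.2 i)
  rw [integral_sub hi1 hi2, he1, he2, sum_freqProj_mul, sum_freqProj_mul,
    sum_freq_mul_coef hτL hτdiv m, sum_freq_mul_coef hu₀ hu₀_div m] at h
  have hint : ∫ t in (0 : ℝ)..τ, projStress m i (u t) =
      ∫ t in (0 : ℝ)..τ, ∫ x, (∑ l, deriv (fun _ : ℝ => modeField m (freqProj m.2 i) x) t l *
        u t x l + ∑ l, ∑ j, pderiv j (modeField m (freqProj m.2 i)) x l *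
          (u t x l * u t x j)) := by
    refine intervalIntegral.integral_congr_ae ?_
    filter_upwards [ae_uIoc_of_ae_timeMeasure hslice
      (a := 0) (b := τ) ⟨le_rfl, (hτ.1.trans hτ.2).le⟩ ⟨hτ.1.le, hτ.2.le⟩] with t ht htm
    simp only [deriv_const, PiLp.zero_apply, zero_mul, Finset.sum_const_zero, zero_add]
    exact (integral_sum_pderiv_modeField (ht htm) m _).symm
  rw [hint, h]
  ring

/-- The time derivative of the mollified inner product of two solutions. -/
def mollRate (n : ℕ) (v w : Torus d → Vec d) : ℝ :=
  ∑ m ∈ modes d n, weight d n m * ((∑ l, stress m l v * coef m (fun x => w x l)) +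
    ∑ l, stress m l w * coef m (fun x => v x l))

lemma integrable_projStress {v : ℝ → Torus d → Vec d}
    (hv : MemLp (Function.uncurry v) 2 (spaceTimeMeasure d T)) (m : Bool × (Fin d → ℤ))
    (i : Fin d) : Integrable (fun t => projStress m i (v t)) (timeMeasure T) :=
  integrable_finsetSum _ fun l _ => (integrable_stress hv m l).const_mul _

/-- This replaces testing one solution with the other. Only finitely many modes occur, each
coefficient agrees almost everywhere with an absolutely continuous function, and the product rule
for primitives applies to each pair. -/
lemma IsWeakSolution.mollInner_eq {u₀ : Torus d → Vec d} {u U : ℝ → Torus d → Vec d}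
    (hT : 0 ≤ T) (hu : IsWeakSolution T u₀ u) (hU : IsWeakSolution T u₀ U)
    (hu₀ : MemLp u₀ 2 volume) (hu₀_div : IsWeaklyDivFree u₀) (n : ℕ) :
    AEStronglyMeasurable (fun t => mollRate n (u t) (U t)) (timeMeasure T) ∧
    ∀ᵐ τ ∂(timeMeasure T), ∑ i, mollInner n (fun x => u τ x i) (fun x => U τ x i) =
      ∑ i, mollInner n (fun x => u₀ x i) (fun x => u₀ x i) +
        ∫ t in (0 : ℝ)..τ, mollRate n (u t) (U t) := by
  have hcu := hu.ae_coef_eq hu₀ hu₀_div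
  have hcU := hU.ae_coef_eq hu₀ hu₀_div
  have hF (m : Bool × (Fin d → ℤ)) (i : Fin d) :
      IntervalIntegrable (fun t => projStress m i (u t)) volume 0 T :=
    (intervalIntegrable_iff_timeMeasure hT).2 (integrable_projStress hu.memLp m i)
  have hG (m : Bool × (Fin d → ℤ)) (i : Fin d) :
      IntervalIntegrable (fun t => projStress m i (U t)) volume 0 T :=
    (intervalIntegrable_iff_timeMeasure hT).2 (integrable_projStress hU.memLp m i)
  set f : Bool × (Fin d → ℤ) → Fin d → ℝ → ℝ := fun m i τ =>
    coef m (fun x => u₀ x i) + ∫ t in (0 : ℝ)..τ, projStress m i (u t)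
  set g : Bool × (Fin d → ℤ) → Fin d → ℝ → ℝ := fun m i τ =>
    coef m (fun x => u₀ x i) + ∫ t in (0 : ℝ)..τ, projStress m i (U t)
  set r : Bool × (Fin d → ℤ) → Fin d → ℝ → ℝ := fun m i t =>
    projStress m i (u t) * g m i t + f m i t * projStress m i (U t)
  have hr (m : Bool × (Fin d → ℤ)) (i : Fin d) : IntervalIntegrable (r m i) volume 0 T := by
    refine (intervalIntegrable_mul_primitive hT (hF m i) (hG m i) _).add ?_
    simp only [f, mul_comm (_ + _) (projStress _ _ _)]
    exact intervalIntegrable_mul_primitive hT (hG m i) (hF m i) _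
  set R : ℝ → ℝ := fun t => ∑ m ∈ modes d n, weight d n m * ∑ i, r m i t
  have hrsum (m : Bool × (Fin d → ℤ)) :
      IntervalIntegrable (fun t => ∑ i, r m i t) volume 0 T := by
    simpa only [Finset.sum_fn] using IntervalIntegrable.sum Finset.univ fun i _ => hr m i
  have hR : IntervalIntegrable R volume 0 T := by
    simpa only [Finset.sum_fn] using
      IntervalIntegrable.sum (modes d n) fun m _ => (hrsum m).const_mul (weight d n m)
  -- Off a null set the primitives are the actual coefficients, and solenoidality of the paired
  -- field removes the projections.
  have hae : ∀ᵐ t ∂(timeMeasure T), R t = mollRate n (u t) (U t) := by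
    filter_upwards [hcu, hcU, ae_memLp_slice hu.memLp, ae_memLp_slice hU.memLp,
      hu.divFree, hU.divFree] with t h1 h2 h3 h4 h5 h6
    refine Finset.sum_congr rfl fun m _ => ?_
    rw [← sum_projStress_mul_coef m (u t) h4 h6, ← sum_projStress_mul_coef m (U t) h3 h5,
      ← Finset.sum_add_distrib]
    congr 1
    refine Finset.sum_congr rfl fun i _ => ?_
    simp only [r, f, g, ← h1, ← h2]
    ring
  refine ⟨((intervalIntegrable_iff_timeMeasure hT).1 hR).aestronglyMeasurable.congr hae, ?_⟩
  filter_upwards [hcu, hcU, ae_restrict_mem measurableSet_Ioo] with τ h1 h2 hτ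
  have h0 : (0 : ℝ) ∈ Icc 0 T := ⟨le_rfl, hT⟩
  have hτ' : τ ∈ Icc 0 T := ⟨hτ.1.le, hτ.2.le⟩
  have hRτ : ∫ t in (0 : ℝ)..τ, mollRate n (u t) (U t) = ∫ t in (0 : ℝ)..τ, R t := by
    refine intervalIntegral.integral_congr_ae ?_
    filter_upwards [ae_uIoc_of_ae_timeMeasure hae h0 hτ'] with t ht htm
    exact (ht htm).symm
  rw [hRτ, intervalIntegral.integral_finsetSum fun m _ =>
    intervalIntegrable_of_mem ((hrsum m).const_mul _) h0 hτ']
  simp only [mollInner]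
  rw [Finset.sum_comm, Finset.sum_comm (s := Finset.univ) (t := modes d n),
    ← Finset.sum_add_distrib]
  refine Finset.sum_congr rfl fun m _ => ?_
  rw [intervalIntegral.integral_const_mul, intervalIntegral.integral_finsetSum fun i _ =>
    intervalIntegrable_of_mem (hr m i) h0 hτ', ← Finset.mul_sum, ← Finset.mul_sum, ← mul_add,
    ← Finset.sum_add_distrib]
  congr 1
  refine Finset.sum_congr rfl fun i _ => ?_
  rw [h1 m i, h2 m i]
  exact mul_primitive_eq (hF m i) (hG m i) _ _ hτ'

/-! ### Passage to the limit -/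

lemma integral_norm_sq {v : Torus d → Vec d} (hv : MemLp v 2 volume) :
    ∫ x, ‖v x‖ ^ 2 = ∑ i, ∫ x, v x i ^ 2 := by
  simp only [EuclideanSpace.real_norm_sq_eq]
  exact integral_finsetSum _ fun i _ => (memLp_apply hv i).integrable_sq

lemma integral_apply_sq_le {v : Torus d → Vec d} (hv : MemLp v 2 volume) (i : Fin d) :
    ∫ x, v x i ^ 2 ≤ ∫ x, ‖v x‖ ^ 2 := by
  rw [integral_norm_sq hv]
  exact Finset.single_le_sum (f := fun i => ∫ x, v x i ^ 2)
    (fun j _ => integral_nonneg fun x => sq_nonneg _) (Finset.mem_univ i)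

/-- The limit of `mollRate` for a velocity `v` and a `C¹` velocity `V`. -/
def limitRate (v V : Torus d → Vec d) : ℝ :=
  (∑ l, ∑ j, ∫ x, symGrad V x l j * (v x l * v x j)) -
    2 * ∑ l, ∑ j, ∫ x, symGrad V x l j * V x j * v x l

lemma mollRate_eq (n : ℕ) {v V : Torus d → Vec d} (hv : MemLp v 2 volume)
    (hvdiv : IsWeaklyDivFree v) (hV : IsC1 V) (hVL : MemLp V 2 volume)
    (hVdiv : IsWeaklyDivFree V) :
    mollRate n v V =
      (∑ l, ∑ j, mollInner n (fun x => symGrad V x l j) (fun x => v x l * v x j)) -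
        2 * ∑ l, ∑ j, mollInner n (fun x => symGrad V x l j * V x j) (fun x => v x l) := by
  simp only [mollRate, mul_add, Finset.sum_add_distrib]
  rw [sum_weight_stress_mul_coef_of_isC1 n hv hV,
    sum_weight_coef_mul_stress_of_isC1 n hv hvdiv hV hVL hVdiv]
  simp only [mollInner_comm n (fun x => v x _)]
  ring

lemma tendsto_mollRate {v V : Torus d → Vec d} (hv : MemLp v 2 volume)
    (hvdiv : IsWeaklyDivFree v) (hV : IsC1 V) (hVL : MemLp V 2 volume)
    (hVdiv : IsWeaklyDivFree V) :
    Tendsto (fun n => mollRate n v V) atTop (𝓝 (limitRate v V)) := by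
  simp only [mollRate_eq _ hv hvdiv hV hVL hVdiv]
  refine (tendsto_finsetSum _ fun l _ => tendsto_finsetSum _ fun j _ => ?_).sub
    ((tendsto_finsetSum _ fun l _ => tendsto_finsetSum _ fun j _ => ?_).const_mul 2)
  · exact tendsto_mollInner (continuous_symGrad hV l j) (integrable_apply_mul_apply hv hv l j)
  · exact tendsto_mollInner ((continuous_symGrad hV l j).mul (hV.apply j).continuous)
      ((memLp_apply hv l).integrable one_le_two)

/-- This is the dominating function in time. It must be affine in `g`, because `‖∇_sym U‖_∞` is only
integrable in time. The factor 3 counts the first double sum once and the second twice. -/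
lemma abs_mollRate_le {n : ℕ} {v V : Torus d → Vec d} (hv : MemLp v 2 volume)
    (hvdiv : IsWeaklyDivFree v) (hV : IsC1 V) (hVL : MemLp V 2 volume)
    (hVdiv : IsWeaklyDivFree V) {M g : ℝ} (hvM : ∫ x, ‖v x‖ ^ 2 ≤ M) (hVM : ∫ x, ‖V x‖ ^ 2 ≤ M)
    (hg0 : 0 ≤ g) (hg : ∀ l j x, |symGrad V x l j| ≤ g) :
    |mollRate n v V| ≤ 3 * d ^ 2 * M * (g + 1) := by
  have hM : 0 ≤ M := (integral_nonneg fun x => sq_nonneg _).trans hvM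
  have hMg : g * M ≤ M * (g + 1) := by nlinarith
  have h1 (l j : Fin d) :
      |mollInner n (fun x => symGrad V x l j) (fun x => v x l * v x j)| ≤ M * (g + 1) := by
    refine (abs_mollInner_le_of_bounded (integrable_of_continuous (continuous_symGrad hV l j))
      (integrable_apply_mul_apply hv hv l j) (hg l j)).trans
      ((mul_le_mul_of_nonneg_left ?_ hg0).trans hMg)
    have i1 := (memLp_apply hv l).integrable_sq
    have i2 := (memLp_apply hv j).integrable_sq
    have hle : ∫ x, |v x l * v x j| ≤ ∫ x, (v x l ^ 2 + v x j ^ 2) / 2 := by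
      refine integral_mono (integrable_apply_mul_apply hv hv l j).abs
        ((i1.add i2).div_const 2) fun x => ?_
      simp only
      rw [abs_le]
      constructor <;> nlinarith [sq_nonneg (v x l - v x j), sq_nonneg (v x l + v x j)]
    rw [integral_div, integral_add i1 i2] at hle
    linarith [integral_apply_sq_le hv l, integral_apply_sq_le hv j]
  have h2 (l j : Fin d) :
      |mollInner n (fun x => symGrad V x l j * V x j) (fun x => v x l)| ≤ M * (g + 1) := by
    have hSV : Continuous (fun x => symGrad V x l j * V x j) :=
      (continuous_symGrad hV l j).mul (hV.apply j).continuous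
    have hSVL : MemLp (fun x => symGrad V x l j * V x j) 2 volume :=
      hSV.memLp_of_hasCompactSupport (HasCompactSupport.of_compactSpace _)
    have hsq : ∫ x, (symGrad V x l j * V x j) ^ 2 ≤ g ^ 2 * M := by
      refine (integral_mono hSVL.integrable_sq
        ((memLp_apply hVL j).integrable_sq.const_mul (g ^ 2)) fun x => ?_).trans ?_
      · simp only [mul_pow]
        exact mul_le_mul_of_nonneg_right (sq_le_sq' (neg_le_of_abs_le (hg l j x))
          (le_of_abs_le (hg l j x))) (sq_nonneg _)
      · rw [integral_const_mul]
        exact mul_le_mul_of_nonneg_left ((integral_apply_sq_le hVL j).trans hVM) (sq_nonneg _)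
    rw [mollInner_comm]
    -- Weighting Young's inequality by `g + 1` turns the quadratic `g ^ 2 * M` into a linear bound;
    -- the added 1 keeps the weight positive when `g = 0`.
    have hg1 : 0 < g + 1 := by linarith
    refine (abs_mollInner_le_weighted (memLp_apply hv l) hSVL hg1).trans ?_
    have e1 : (g + 1) * ∫ x, v x l ^ 2 ≤ M * (g + 1) := by
      rw [mul_comm]
      exact mul_le_mul_of_nonneg_right ((integral_apply_sq_le hv l).trans hvM) hg1.le
    have e2 : (g + 1)⁻¹ * ∫ x, (symGrad V x l j * V x j) ^ 2 ≤ M * (g + 1) := by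
      rw [inv_mul_le_iff₀ hg1]
      refine hsq.trans ?_
      have : g ^ 2 * M ≤ (g + 1) ^ 2 * M :=
        mul_le_mul_of_nonneg_right (by nlinarith) hM
      nlinarith
    linarith
  rw [mollRate_eq n hv hvdiv hV hVL hVdiv]
  have hsum {a : Fin d → Fin d → ℝ} (ha : ∀ l j, |a l j| ≤ M * (g + 1)) :
      |∑ l, ∑ j, a l j| ≤ d ^ 2 * (M * (g + 1)) := by
    refine (Finset.abs_sum_le_sum_abs _ _).trans ((Finset.sum_le_sum fun l _ =>
      (Finset.abs_sum_le_sum_abs _ _).trans (Finset.sum_le_sum fun j _ => ha l j)).trans_eq ?_)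
    simp
    ring
  have a1 := hsum h1
  have a2 := hsum h2
  rw [abs_le] at a1 a2 ⊢
  constructor <;> nlinarith [a1.1, a1.2, a2.1, a2.2]

lemma limitRate_self {V : Torus d → Vec d} (hV : IsC1 V) (hVdiv : IsWeaklyDivFree V) :
    limitRate V V = 0 := by
  have h := sum_integral_symGrad_mul_self hV hVdiv
  have h1 : ∑ l, ∑ j, ∫ x, symGrad V x l j * (V x l * V x j) = 0 := by
    rw [← h]
    refine Finset.sum_congr rfl fun l _ => Finset.sum_congr rfl fun j _ =>
      integral_congr_ae (Eventually.of_forall fun x => by simp only; ring)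
  have h2 : ∑ l, ∑ j, ∫ x, symGrad V x l j * V x j * V x l = 0 := by
    rw [← h]
    refine Finset.sum_congr rfl fun l _ => Finset.sum_congr rfl fun j _ =>
      integral_congr_ae (Eventually.of_forall fun x => by simp only; ring)
  rw [limitRate, h1, h2]
  ring

lemma symGrad_comm (V : Torus d → Vec d) (x : Torus d) (l j : Fin d) :
    symGrad V x l j = symGrad V x j l := by
  simp only [symGrad, add_comm]

/-- Adding the vanishing term `∫ S : (V ⊗ V)`, with `S = symGrad V`, completes the square, so that
`limitRate v V = ∫ S : (w ⊗ w)` with `w = v - V`. The factor `d` comes from summing `(w l ^ 2 + w j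
^ 2) / 2` over both indices. -/
lemma neg_limitRate_le {v V : Torus d → Vec d} (hv : MemLp v 2 volume) (hV : IsC1 V)
    (hVL : MemLp V 2 volume) (hVdiv : IsWeaklyDivFree V) {g : ℝ}
    (hg : ∀ l j x, |symGrad V x l j| ≤ g) :
    -limitRate v V ≤ d * g * ∫ x, ‖v x - V x‖ ^ 2 := by
  have hw : MemLp (fun x => v x - V x) 2 volume := hv.sub hVL
  have hS {f : Torus d → ℝ} (hf : Integrable f volume) (l j : Fin d) :
      Integrable (fun x => symGrad V x l j * f x) volume :=
    integrable_continuous_mul (continuous_symGrad hV l j) hf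
  have hvv (l j : Fin d) := hS (integrable_apply_mul_apply hv hv l j) l j
  have hVv (l j : Fin d) := hS (integrable_apply_mul_apply hVL hv j l) l j
  have hVV (l j : Fin d) := hS (integrable_apply_mul_apply hVL hVL l j) l j
  have hww (l j : Fin d) := hS (integrable_apply_mul_apply hw hw l j) l j
  have h0 : ∑ l, ∑ j, ∫ x, symGrad V x l j * (V x l * V x j) = 0 := by
    rw [← sum_integral_symGrad_mul_self hV hVdiv]
    refine Finset.sum_congr rfl fun l _ => Finset.sum_congr rfl fun j _ =>
      integral_congr_ae (Eventually.of_forall fun x => by simp only; ring)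
  have hexp (l j : Fin d) :
      ∫ x, symGrad V x l j * ((v x - V x) l * (v x - V x) j) =
        (∫ x, symGrad V x l j * (v x l * v x j)) - (∫ x, symGrad V x l j * (V x j * v x l)) -
          (∫ x, symGrad V x j l * (V x l * v x j)) +
          ∫ x, symGrad V x l j * (V x l * V x j) := by
    have i1 : Integrable (fun x => symGrad V x l j * (v x l * v x j) -
        symGrad V x l j * (V x j * v x l)) volume := (hvv l j).sub (hVv l j)
    have i2 : Integrable (fun x => symGrad V x l j * (v x l * v x j) -
        symGrad V x l j * (V x j * v x l) - symGrad V x j l * (V x l * v x j)) volume :=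
      i1.sub (hVv j l)
    rw [← integral_sub (hvv l j) (hVv l j), ← integral_sub i1 (hVv j l),
      ← integral_add i2 (hVV l j)]
    refine integral_congr_ae (Eventually.of_forall fun x => ?_)
    simp only [PiLp.sub_apply, symGrad_comm V x j l]
    ring
  have hlim : limitRate v V =
      ∑ l, ∑ j, ∫ x, symGrad V x l j * ((v x - V x) l * (v x - V x) j) := by
    simp only [hexp, Finset.sum_add_distrib, Finset.sum_sub_distrib]
    rw [h0, Finset.sum_comm (f := fun l j => ∫ x, symGrad V x j l * (V x l * v x j)), limitRate]
    simp only [mul_assoc]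
    ring
  have hsum : ∑ l, ∑ j, ∫ x, symGrad V x l j * ((v x - V x) l * (v x - V x) j) =
      ∫ x, ∑ l, ∑ j, symGrad V x l j * ((v x - V x) l * (v x - V x) j) := by
    rw [integral_finsetSum _ fun l _ => integrable_finsetSum _ fun j _ => hww l j]
    exact Finset.sum_congr rfl fun l _ => (integral_finsetSum _ fun j _ => hww l j).symm
  rw [hlim, hsum, ← integral_neg, ← integral_const_mul]
  refine integral_mono (integrable_finsetSum _ fun l _ =>
    integrable_finsetSum _ fun j _ => hww l j).neg
    (((memLp_two_iff_integrable_sq_norm hw.1).1 hw).const_mul _) fun x => ?_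
  set w := v x - V x
  simp only [EuclideanSpace.real_norm_sq_eq]
  have hpt (l j : Fin d) : -(symGrad V x l j * (w l * w j)) ≤ g * ((w l ^ 2 + w j ^ 2) / 2) := by
    have h1 : |symGrad V x l j * (w l * w j)| ≤ g * ((w l ^ 2 + w j ^ 2) / 2) := by
      rw [abs_mul]
      refine mul_le_mul (hg l j x) ?_ (abs_nonneg _) ((abs_nonneg _).trans (hg l j x))
      rw [abs_le]
      constructor <;> nlinarith [sq_nonneg (w l - w j), sq_nonneg (w l + w j)]
    exact (neg_le_abs _).trans h1
  calc -∑ l, ∑ j, symGrad V x l j * (w l * w j)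
      = ∑ l, ∑ j, -(symGrad V x l j * (w l * w j)) := by simp only [Finset.sum_neg_distrib]
    _ ≤ ∑ l, ∑ j, g * ((w l ^ 2 + w j ^ 2) / 2) :=
        Finset.sum_le_sum fun l _ => Finset.sum_le_sum fun j _ => hpt l j
    _ = d * g * ∑ i, w i ^ 2 := by
        simp only [← Finset.mul_sum, ← Finset.sum_div, Finset.sum_add_distrib, Finset.sum_const,
          Finset.card_univ, Fintype.card_fin, nsmul_eq_mul]
        ring

/-- The inner product of a weak solution with a spatially `C¹` weak solution evolves by
`limitRate`. -/
lemma IsWeakSolution.integral_inner_eq {u₀ : Torus d → Vec d} {u U : ℝ → Torus d → Vec d}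
    (hT : 0 ≤ T) (hu₀ : MemLp u₀ 2 volume) (hu₀_div : IsWeaklyDivFree u₀)
    (hu : IsWeakSolution T u₀ u) (hu_energy : MemLpLq ∞ 2 T u)
    (hU : IsWeakSolution T u₀ U) (hU_energy : MemLpLq ∞ 2 T U)
    (hU_C1 : ∀ᵐ t ∂(timeMeasure T), IsC1 (U t))
    (hU_symGrad : MemLpLq 1 ∞ T (fun t => symGrad (U t))) :
    Integrable (fun t => limitRate (u t) (U t)) (timeMeasure T) ∧
    ∀ᵐ τ ∂(timeMeasure T), ∑ i, ∫ x, u τ x i * U τ x i =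
      (∫ x, ‖u₀ x‖ ^ 2) + ∫ t in (0 : ℝ)..τ, limitRate (u t) (U t) := by
  obtain ⟨M₁, hM₁⟩ := hu_energy.exists_ae_integral_le hu.memLp
  obtain ⟨M₂, hM₂⟩ := hU_energy.exists_ae_integral_le hU.memLp
  set M := max M₁ M₂
  have huL := ae_memLp_slice hu.memLp
  have hUL := ae_memLp_slice hU.memLp
  have hmoll (n : ℕ) := hu.mollInner_eq hT hU hu₀ hu₀_div n
  have hbound : ∀ᵐ t ∂(timeMeasure T), ∀ n, ‖mollRate n (u t) (U t)‖ ≤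
      3 * d ^ 2 * M * (symGradNorm (U t) + 1) := by
    filter_upwards [hM₁, hM₂, huL, hUL, hu.divFree, hU.divFree, hU_C1,
      hU_symGrad.ae_abs_symGrad_le hU_C1] with t h1 h2 h3 h4 h5 h6 h7 h8 n
    exact abs_mollRate_le h3 h5 h7 h4 h6 (h1.trans (le_max_left _ _)) (h2.trans (le_max_right _ _))
      ENNReal.toReal_nonneg h8
  have hlim : ∀ᵐ t ∂(timeMeasure T),
      Tendsto (fun n => mollRate n (u t) (U t)) atTop (𝓝 (limitRate (u t) (U t))) := by
    filter_upwards [huL, hUL, hu.divFree, hU.divFree, hU_C1] with t h3 h4 h5 h6 h7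
    exact tendsto_mollRate h3 h5 h7 h4 h6
  have hBi : Integrable (fun t => 3 * d ^ 2 * M * (symGradNorm (U t) + 1)) (timeMeasure T) :=
    (hU_symGrad.integrable_symGradNorm.add (integrable_const 1)).const_mul _
  have hBi' := (intervalIntegrable_iff_timeMeasure hT).2 hBi
  have hmeas : AEStronglyMeasurable (fun t => limitRate (u t) (U t)) (timeMeasure T) :=
    aestronglyMeasurable_of_tendsto_ae atTop (fun n => (hmoll n).1) hlim
  refine ⟨hBi.mono' hmeas ?_, ?_⟩
  · filter_upwards [hbound, hlim] with t h1 h2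
    exact le_of_tendsto h2.norm (Eventually.of_forall h1)
  filter_upwards [ae_all_iff.2 fun n => (hmoll n).2, ae_restrict_mem measurableSet_Ioo, huL, hU_C1]
    with τ hτeq hτ hτL hτC1
  have h0 : (0 : ℝ) ∈ Icc 0 T := ⟨le_rfl, hT⟩
  have hτ' : τ ∈ Icc 0 T := ⟨hτ.1.le, hτ.2.le⟩
  have hL : Tendsto (fun n => ∑ i, mollInner n (fun x => u τ x i) (fun x => U τ x i)) atTop
      (𝓝 (∑ i, ∫ x, u τ x i * U τ x i)) := by
    refine tendsto_finsetSum _ fun i _ => ?_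
    simp only [mollInner_comm _ (fun x => u τ x i), mul_comm (u τ _ i)]
    exact tendsto_mollInner (hτC1.apply i).continuous
      ((memLp_apply hτL i).integrable one_le_two)
  -- Neither factor is continuous here, so the `L²` version of the limit is required.
  have hI : Tendsto (fun n => ∑ i, mollInner n (fun x => u₀ x i) (fun x => u₀ x i)) atTop
      (𝓝 (∫ x, ‖u₀ x‖ ^ 2)) := by
    rw [integral_norm_sq hu₀]
    exact tendsto_finsetSum _ fun i _ => tendsto_mollInner_self (memLp_apply hu₀ i)
  have hR : Tendsto (fun n => ∫ t in (0 : ℝ)..τ, mollRate n (u t) (U t)) atTop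
      (𝓝 (∫ t in (0 : ℝ)..τ, limitRate (u t) (U t))) := by
    refine intervalIntegral.tendsto_integral_filter_of_dominated_convergence
      (fun t => 3 * d ^ 2 * M * (symGradNorm (U t) + 1)) (Eventually.of_forall fun n => ?_)
      (Eventually.of_forall fun n => ?_) (intervalIntegrable_of_mem hBi' h0 hτ')
      (ae_uIoc_of_ae_timeMeasure hlim h0 hτ')
    · refine (hmoll n).1.mono_measure ?_
      rw [timeMeasure_eq_restrict_Ioc, uIoc_of_le hτ.1.le]
      exact Measure.restrict_mono (Ioc_subset_Ioc_right hτ.2.le) le_rfl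
    · exact ae_uIoc_of_ae_timeMeasure (hbound.mono fun t ht => ht n) h0 hτ'
  exact tendsto_nhds_unique hL ((hI.add hR).congr fun n => (hτeq n).symm)

/-! ### Relative energy and uniqueness -/

lemma integral_norm_sub_sq {v w : Torus d → Vec d} (hv : MemLp v 2 volume)
    (hw : MemLp w 2 volume) :
    ∫ x, ‖v x - w x‖ ^ 2 =
      (∫ x, ‖v x‖ ^ 2) + (∫ x, ‖w x‖ ^ 2) - 2 * ∑ i, ∫ x, v x i * w x i := by
  have hvw : MemLp (fun x => v x - w x) 2 volume := hv.sub hw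
  rw [integral_norm_sq hvw, integral_norm_sq hv, integral_norm_sq hw, Finset.mul_sum,
    ← Finset.sum_add_distrib, ← Finset.sum_sub_distrib]
  refine Finset.sum_congr rfl fun i _ => ?_
  have h1 := (memLp_apply hv i).integrable_sq
  have h2 := (memLp_apply hw i).integrable_sq
  have h3 := (integrable_apply_mul_apply hv hw i i).const_mul 2
  have h12 : Integrable (fun x => v x i ^ 2 + w x i ^ 2) volume := h1.add h2
  rw [← integral_const_mul, ← integral_add h1 h2, ← integral_sub h12 h3]
  refine integral_congr_ae (Eventually.of_forall fun x => ?_)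
  simp only [PiLp.sub_apply]
  ring

/-- The relative energy of an admissible weak solution and a strong solution vanishes. -/
lemma IsGloballyAdmissible.ae_relativeEnergy_eq_zero {u₀ : Torus d → Vec d}
    {u U : ℝ → Torus d → Vec d} (hT : 0 ≤ T) (hu₀ : MemLp u₀ 2 volume)
    (hu₀_div : IsWeaklyDivFree u₀) (hu : IsGloballyAdmissible T u₀ u)
    (hU : IsWeakSolution T u₀ U) (hU_energy : MemLpLq ∞ 2 T U)
    (hU_C1 : ∀ᵐ t ∂(timeMeasure T), IsC1 (U t))
    (hU_symGrad : MemLpLq 1 ∞ T (fun t => symGrad (U t))) :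
    ∀ᵐ t ∂(timeMeasure T), ∫ x, ‖u t x - U t x‖ ^ 2 = 0 := by
  have huw := hu.toIsWeakSolution
  have huL := ae_memLp_slice huw.memLp
  have hUL := ae_memLp_slice hU.memLp
  have hwL : MemLp (Function.uncurry fun t x => u t x - U t x) 2 (spaceTimeMeasure d T) :=
    huw.memLp.sub hU.memLp
  have hg := hU_symGrad.ae_abs_symGrad_le hU_C1
  obtain ⟨M₁, hM₁⟩ := hu.memLinftyL2.exists_ae_integral_le huw.memLp
  obtain ⟨M₂, hM₂⟩ := hU_energy.exists_ae_integral_le hU.memLp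
  obtain ⟨hHi, hH⟩ := huw.integral_inner_eq hT hu₀ hu₀_div hu.memLinftyL2 hU hU_energy hU_C1
    hU_symGrad
  -- Pairing `U` with itself, where the rate vanishes, yields conservation of its energy.
  obtain ⟨-, hHU⟩ := hU.integral_inner_eq hT hu₀ hu₀_div hU_energy hU hU_energy hU_C1 hU_symGrad
  set E : ℝ → ℝ := fun t => ∫ x, ‖u t x - U t x‖ ^ 2
  set G : ℝ → ℝ := fun t => 2 * (d * symGradNorm (U t))
  have hE0 (t : ℝ) : 0 ≤ E t := integral_nonneg fun x => sq_nonneg _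
  have hG0 (t : ℝ) : 0 ≤ G t := by
    have : 0 ≤ symGradNorm (U t) := ENNReal.toReal_nonneg
    positivity
  have hGi : Integrable G (timeMeasure T) :=
    (hU_symGrad.integrable_symGradNorm.const_mul _).const_mul _
  have hEi : Integrable E (timeMeasure T) := integrable_integral_norm_sq hwL
  -- An essential bound on `E` is needed because `G` is merely integrable, so that `G * E` is
  -- integrable.
  have hEM : ∀ᵐ t ∂(timeMeasure T), ‖E t‖ ≤ 2 * (M₁ + M₂) := by
    filter_upwards [hM₁, hM₂, huL, hUL] with t h1 h2 h3 h4
    rw [Real.norm_of_nonneg (hE0 t)]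
    have hsum : E t ≤ 2 * ((∫ x, ‖u t x‖ ^ 2) + ∫ x, ‖U t x‖ ^ 2) := by
      have i1 := (memLp_two_iff_integrable_sq_norm h3.1).1 h3
      have i2 := (memLp_two_iff_integrable_sq_norm h4.1).1 h4
      rw [← integral_add i1 i2, ← integral_const_mul]
      refine integral_mono ((memLp_two_iff_integrable_sq_norm (h3.sub h4).1).1 (h3.sub h4))
        ((i1.add i2).const_mul 2) fun x => ?_
      simp only
      nlinarith [norm_sub_le (u t x) (U t x), norm_nonneg (u t x - U t x),
        sq_nonneg (‖u t x‖ - ‖U t x‖)]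
    linarith
  have hGE : Integrable (fun t => G t * E t) (timeMeasure T) :=
    hGi.mul_bdd hEi.aestronglyMeasurable hEM
  refine ae_eq_zero_of_le_integral hT hE0 hG0 hGi hGE ?_
  have hrate : ∀ᵐ t ∂(timeMeasure T), -2 * limitRate (u t) (U t) ≤ G t * E t := by
    filter_upwards [hg, hU_C1, hU.divFree, huL, hUL] with t h1 h2 h3 h4 h5
    have := neg_limitRate_le h4 h2 h5 h3 h1
    simp only [G, E]
    linarith
  have hself : ∀ᵐ t ∂(timeMeasure T), limitRate (U t) (U t) = 0 := by
    filter_upwards [hU_C1, hU.divFree] with t h1 h2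
    exact limitRate_self h1 h2
  have hHi' := (intervalIntegrable_iff_timeMeasure hT).2 hHi
  have hGE' := (intervalIntegrable_iff_timeMeasure hT).2 hGE
  filter_upwards [hH, hHU, hu.energy_le, huL, hUL, ae_restrict_mem measurableSet_Ioo]
    with τ h1 h2 h3 h4 h5 hτ
  have h0 : (0 : ℝ) ∈ Icc 0 T := ⟨le_rfl, hT⟩
  have hτ' : τ ∈ Icc 0 T := ⟨hτ.1.le, hτ.2.le⟩
  have hz : ∫ t in (0 : ℝ)..τ, limitRate (U t) (U t) = 0 := by
    rw [intervalIntegral.integral_congr_ae (g := fun _ => (0 : ℝ))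
      (ae_uIoc_of_ae_timeMeasure hself h0 hτ')]
    simp
  have hUU : ∫ x, ‖U τ x‖ ^ 2 = ∫ x, ‖u₀ x‖ ^ 2 := by
    rw [hz, add_zero] at h2
    rw [integral_norm_sq h5, ← h2]
    simp only [sq]
  -- In the expanded square, `∫ |u|²` is at most and `∫ |U|²` equals the initial energy; together
  -- they cancel the initial term of `2 ∫ u · U`.
  have hEτ : E τ ≤ ∫ t in (0 : ℝ)..τ, -2 * limitRate (u t) (U t) := by
    rw [intervalIntegral.integral_const_mul]
    simp only [E]
    rw [integral_norm_sub_sq h4 h5, hUU, h1]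
    linarith
  refine hEτ.trans (intervalIntegral.integral_mono_ae_restrict hτ.1.le
    ((intervalIntegrable_of_mem hHi' h0 hτ').const_mul _)
    (intervalIntegrable_of_mem hGE' h0 hτ') ?_)
  have hae := ae_uIoc_of_ae_timeMeasure hrate h0 hτ'
  rw [uIoc_of_le hτ.1.le, ← ae_restrict_iff' measurableSet_Ioc,
    Measure.restrict_congr_set Ioc_ae_eq_Icc] at hae
  exact hae

lemma ae_eq_of_ae_integral_norm_sub_sq {u U : ℝ → Torus d → Vec d}
    (hu : MemLp (Function.uncurry u) 2 (spaceTimeMeasure d T))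
    (hU : MemLp (Function.uncurry U) 2 (spaceTimeMeasure d T))
    (h : ∀ᵐ t ∂(timeMeasure T), ∫ x, ‖u t x - U t x‖ ^ 2 = 0) :
    ∀ᵐ z ∂(spaceTimeMeasure d T), u z.1 z.2 = U z.1 z.2 := by
  have hw := hu.sub hU
  have hi : Integrable (fun z : ℝ × Torus d => ‖u z.1 z.2 - U z.1 z.2‖ ^ 2)
      ((timeMeasure T).prod volume) := (memLp_two_iff_integrable_sq_norm hw.1).1 hw
  have hzero : ∫ z, ‖u z.1 z.2 - U z.1 z.2‖ ^ 2 ∂((timeMeasure T).prod volume) = 0 := by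
    rw [integral_prod _ hi]
    exact integral_eq_zero_of_ae h
  rw [integral_eq_zero_iff_of_nonneg (fun z => sq_nonneg _) hi] at hzero
  filter_upwards [hzero] with z hz
  simpa [sub_eq_zero] using hz

end EulerTorus

end

theorem mainTheorem6 (d : ℕ) (T : ℝ) (hT : 0 < T)
    (u₀ : EulerTorus.Torus d → EulerTorus.Vec d)
    (hu₀ : MemLp u₀ 2 volume) (hu₀_div : EulerTorus.IsWeaklyDivFree u₀)
    (u U : ℝ → EulerTorus.Torus d → EulerTorus.Vec d)
    (hu : EulerTorus.IsGloballyAdmissible T u₀ u)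
    (hU : EulerTorus.IsWeakSolution T u₀ U)
    (hU_energy : EulerTorus.MemLpLq ∞ 2 T U)
    (hU_C1 : ∀ᵐ t ∂(EulerTorus.timeMeasure T), EulerTorus.IsC1 (U t))
    (hU_symGrad : EulerTorus.MemLpLq 1 ∞ T (fun t => EulerTorus.symGrad (U t))) :
    ∀ᵐ z ∂(EulerTorus.spaceTimeMeasure d T), u z.1 z.2 = U z.1 z.2 :=
  EulerTorus.ae_eq_of_ae_integral_norm_sub_sq hu.memLp hU.memLp
    (hu.ae_relativeEnergy_eq_zero hT.le hu₀ hu₀_div hU hU_energy hU_C1 hU_symGrad)
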